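/- Let $\Omega$ be either a domain (a nonempty connected open set) in $\mathbb{R}^n$ or a flat torus $\prod_{i=1}^n \mathbb{R}/\omega_i\mathbb{Z}$ with $\omega_i>0$. Let $b\in L^\infty(\Omega)$ be nonnegative with $1/b\in L^\infty(\Omega)$, and let $L^2_b(\Omega)$ be the Hilbert space $L^2(\Omega)$ with the inner product $(u,v)_{L^2_b}=\int_\Omega b\,u\,v\,dx$. Let $a:\Omega\to[0,\infty]$ be lower semicontinuous and, for $u\in L^2_b(\Omega)$, put $$TV_a(u)=\sup\Big\{-\int_\Omega u\,\operatorname{div}\varphi\,dx \;\Big|\; \varphi\in (C_c^\infty(\Omega))^n,\ |\varphi(x)|\le a(x)\ \text{for all } x\in\Omega\Big\}\in[0,\infty],\qquad D(TV_a)=\{u \in L^2_b(\Omega) \mid TV_a(u)<\infty\}.$$ For $v\in D(TV_a)$ let $\partial_{L^2_b}TV_a(v)$ be the set of $f\in L^2_b(\Omega)$ with $TV_a(v+h)-TV_a(v)\ge (h,f)_{L^2_b}$ for all $h\in L^2_b(\Omega)$; for $v\notin D(TV_a)$ it is empty. A solution of the weighted total variation flow with initial datum $u_0\in L^2_b(\Omega)$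 is a function $u\in C([0,\infty),L^2_b(\Omega))$ with $u_t\in\bigcap_{\delta>0}L^2((\delta,\infty),L^2_b(\Omega))$ such that $u_t(t)\in-\partial_{L^2_b}TV_a(u(t))$ for a.e. $t>0$ and $u(0)=u_0$. Here $u_t$ is the weak time derivative, i.e. $u(t)-u(s)=\int_s^t u_t(r)\,dr$ for all $0<s\le t$. Then: 1. for every $u_0$ in the closure of $D(TV_a)$ in $L^2_b(\Omega)$ there is a unique solution with initial datum $u_0$; 2. if $a$ is locally integrable, i.e. $\int_K a\,dx<\infty$ for every compact $K\subset\Omega$, then for every $u_0\in L^2_b(\Omega)$ there is a unique solution with initial datum $u_0$. -/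

import Mathlib

open MeasureTheory Set Topology
open scoped ENNReal NNReal

noncomputable section

namespace TVFlow

/-! ### The spatial region: a domain of `ℝⁿ` or a flat torus -/

/-- The spatial region `Ω`: either a domain (nonempty connected open set) in `ℝⁿ`, or a flat torus
`∏ᵢ ℝ / τᵢ ℤ` with periods `τᵢ > 0`. -/
inductive Region (n : ℕ) : Type
  | domain (U : Set (EuclideanSpace ℝ (Fin n))) (isOpen : IsOpen U) (isConnected : IsConnected U)
  | torus (τ : Fin n → ℝ) (pos : ∀ i, 0 < τ i)

/-- The points of `Ω`. -/
def Region.Point {n : ℕ} : Region n → Type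
  | .domain U _ _ => U
  | .torus τ _ => ∀ i, AddCircle (τ i)

instance {n : ℕ} : CoeSort (Region n) Type := ⟨Region.Point⟩

/-- The subspace topology of a domain, the product topology of a torus. -/
instance {n : ℕ} : ∀ Ω : Region n, TopologicalSpace Ω
  | .domain U _ _ => inferInstanceAs (TopologicalSpace U)
  | .torus τ _ => inferInstanceAs (TopologicalSpace (∀ i, AddCircle (τ i)))

/-- Lebesgue measure `dx` on `Ω`; on a torus it is the product of the length measures of the
circles `ℝ / τᵢ ℤ`, of total mass `∏ᵢ τᵢ`. -/
instance {n : ℕ} : ∀ Ω : Region n, MeasureSpace Ω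
  | .domain U _ _ => (Measure.Subtype.measureSpace : MeasureSpace U)
  | .torus τ pos =>
    haveI : ∀ i, Fact (0 < τ i) := fun i => ⟨pos i⟩
    inferInstanceAs (MeasureSpace (∀ i, AddCircle (τ i)))

/-- The covering map `ℝⁿ → ∏ᵢ ℝ / τᵢ ℤ`. -/
def torusProj {n : ℕ} (τ : Fin n → ℝ) (y : EuclideanSpace ℝ (Fin n)) : ∀ i, AddCircle (τ i) :=
  fun i => (y i : AddCircle (τ i))

/-- The divergence `∑ᵢ ∂ᵢ Φᵢ` of a vector field on `ℝⁿ`. -/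
def divergence {n : ℕ} (Φ : EuclideanSpace ℝ (Fin n) → EuclideanSpace ℝ (Fin n))
    (y : EuclideanSpace ℝ (Fin n)) : ℝ :=
  ∑ i, fderiv ℝ Φ y (EuclideanSpace.single i 1) i

/-- `IsTestField Ω φ d` means `φ ∈ C_c^∞(Ω)ⁿ` and `div φ = d`.  On a domain, `φ` is the restriction
of a smooth field on `ℝⁿ` whose support is a compact subset of `Ω`; on a torus, smoothness and
divergence are those of the periodic lift of `φ` to `ℝⁿ`. -/
def IsTestField {n : ℕ} : ∀ Ω : Region n, (Ω → EuclideanSpace ℝ (Fin n)) → (Ω → ℝ) → Prop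
  | .domain U _ _, φ, d =>
    ∃ Φ : EuclideanSpace ℝ (Fin n) → EuclideanSpace ℝ (Fin n),
      ContDiff ℝ (⊤ : ℕ∞) Φ ∧ HasCompactSupport Φ ∧ tsupport Φ ⊆ U ∧
        ∀ x : U, φ x = Φ x ∧ d x = divergence Φ x
  | .torus τ _, φ, d =>
    ContDiff ℝ (⊤ : ℕ∞) (fun y => φ (torusProj τ y)) ∧
      ∀ y, d (torusProj τ y) = divergence (fun z => φ (torusProj τ z)) y

/-- The weighted total variation
`TV_a(u) = sup { -∫_Ω u div φ dx | φ ∈ C_c^∞(Ω)ⁿ, |φ(x)| ≤ a(x) for all x ∈ Ω }`. -/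
def weightedTV {n : ℕ} (Ω : Region n) (a : Ω → ℝ≥0∞) (u : Ω → ℝ) : EReal :=
  ⨆ (φ : Ω → EuclideanSpace ℝ (Fin n)) (d : Ω → ℝ) (_ : IsTestField Ω φ d)
    (_ : ∀ x, ENNReal.ofReal ‖φ x‖ ≤ a x), ((-∫ x, u x * d x : ℝ) : EReal)

/-! ### The weighted space `L²_b(Ω)` -/

/-- The measure `b(x) dx` on `Ω`. -/
def weightedMeasure {n : ℕ} (Ω : Region n) (b : Ω → ℝ) : Measure Ω :=
  (volume : Measure Ω).withDensity fun x => ENNReal.ofReal (b x)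

/-- The real Hilbert space `L²_b(Ω)`, realised as `L²` of the measure `b(x) dx`.  When `b` and
`1 / b` are essentially bounded this has the same elements as `L²(Ω)` (`memLp_weightedMeasure_iff`),
and its inner product is `∫_Ω b u v dx` (`inner_L2b`). -/
abbrev L2b {n : ℕ} (Ω : Region n) (b : Ω → ℝ) : Type := Lp ℝ 2 (weightedMeasure Ω b)

/-- `b ≥ 0` is essentially bounded, with an essentially bounded reciprocal.  (That `1 / b` is a
function in `L^∞` includes `b ≠ 0` almost everywhere, which has to be said since `1 / 0 = 0` in
Lean.) -/
structure IsAdmissibleDensity {n : ℕ} (Ω : Region n) (b : Ω → ℝ) : Prop where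
  pos : ∀ᵐ x : Ω, 0 < b x
  memLp : MemLp b ∞ (volume : Measure Ω)
  memLp_inv : MemLp (fun x => 1 / b x) ∞ (volume : Measure Ω)

/-! ### Gradient flows in a real Hilbert space -/

section Hilbert

variable {H : Type*} [NormedAddCommGroup H] [InnerProductSpace ℝ H]

/-- The effective domain `D(E) = { v | E(v) < ∞ }`. -/
def effectiveDomain (E : H → EReal) : Set H := {v | E v < ⊤}

/-- The subdifferential: `f ∈ ∂E(v)` iff `v ∈ D(E)` and `E(v + h) - E(v) ≥ (h, f)` for all `h`. -/
def subdifferential (E : H → EReal) (v : H) : Set H :=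
  {f | v ∈ effectiveDomain E ∧ ∀ h : H, E v + ((inner ℝ h f : ℝ) : EReal) ≤ E (v + h)}

/-- `u ∈ C([0,∞), H)` with `u_t ∈ ⋂_{δ>0} L²((δ,∞), H)` satisfies `u_t(t) ∈ -∂E(u(t))` for a.e.
`t > 0` and `u(0) = u₀`.  Here `g` is the time derivative `u_t`, in the sense that `u` is the
indefinite (Bochner) integral of `g` on every compact interval of `(0,∞)`. -/
def IsGradientFlow [CompleteSpace H] (E : H → EReal) (u₀ : H) (u : C(ℝ≥0, H)) : Prop :=
  ∃ g : ℝ → H,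
    (∀ δ : ℝ, 0 < δ → MemLp g 2 (volume.restrict (Ioi δ))) ∧
    (∀ s t : ℝ≥0, 0 < s → s ≤ t → u t - u s = ∫ r in (s : ℝ)..(t : ℝ), g r) ∧
    (∀ᵐ t : ℝ ∂volume.restrict (Ioi 0), -g t ∈ subdifferential E (u t.toNNReal)) ∧
    u 0 = u₀

end Hilbert

/-- `TV_a` as a functional on `L²_b(Ω)`. -/
def energy {n : ℕ} (Ω : Region n) (a : Ω → ℝ≥0∞) (b : Ω → ℝ) : L2b Ω b → EReal :=
  fun u => weightedTV Ω a u

/-! ### Checks on `L²_b(Ω)` -/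

theorem inner_L2b {n : ℕ} (Ω : Region n) (b : Ω → ℝ) (hb : IsAdmissibleDensity Ω b)
    (u v : L2b Ω b) : inner ℝ u v = ∫ x, b x * u x * v x := by
  have hm : AEMeasurable (fun x => (b x).toNNReal) (volume : Measure Ω) :=
    hb.memLp.aestronglyMeasurable.aemeasurable.real_toNNReal
  rw [L2.inner_def]
  change ∫ x, _ ∂((volume : Measure Ω).withDensity fun x => (((b x).toNNReal : ℝ≥0) : ℝ≥0∞)) = _
  rw [integral_withDensity_eq_integral_smul₀ hm]
  refine integral_congr_ae ?_
  filter_upwards [hb.pos] with x hx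
  simp only [NNReal.smul_def, Real.coe_toNNReal _ hx.le, smul_eq_mul, RCLike.inner_apply,
    conj_trivial]
  ring

theorem memLp_weightedMeasure_iff {n : ℕ} (Ω : Region n) (b : Ω → ℝ)
    (hb : IsAdmissibleDensity Ω b) (f : Ω → ℝ) :
    MemLp f 2 (weightedMeasure Ω b) ↔ MemLp f 2 (volume : Measure Ω) := by
  have hbm : AEMeasurable (fun x => ENNReal.ofReal (b x)) (volume : Measure Ω) :=
    hb.memLp.aestronglyMeasurable.aemeasurable.ennreal_ofReal
  have hpos : ∀ᵐ x : Ω, ENNReal.ofReal (b x) ≠ 0 := by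
    filter_upwards [hb.pos] with x hx
    simpa using hx
  have bound : ∀ c : Ω → ℝ, MemLp c ∞ (volume : Measure Ω) →
      ∃ C : ℝ≥0∞, C ≠ ∞ ∧ ∀ᵐ x : Ω, ENNReal.ofReal (c x) ≤ C := by
    intro c hc
    refine ⟨eLpNorm c ∞ volume, hc.2.ne, ?_⟩
    rw [eLpNorm_exponent_top]
    filter_upwards [ae_le_eLpNormEssSup (f := c) (μ := (volume : Measure Ω))] with x hx
    exact (Real.ofReal_le_enorm (c x)).trans hx
  obtain ⟨C, hC, hCb⟩ := bound b hb.memLp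
  obtain ⟨D, hD, hDb⟩ := bound _ hb.memLp_inv
  constructor
  · intro h
    refine h.of_measure_le_smul hD ?_
    calc (volume : Measure Ω) = volume.withDensity 1 := withDensity_one.symm
      _ ≤ volume.withDensity (D • fun x => ENNReal.ofReal (b x)) := by
        refine withDensity_mono ?_
        filter_upwards [hb.pos, hDb] with x hx hx'
        calc (1 : ℝ≥0∞) = ENNReal.ofReal (1 / b x) * ENNReal.ofReal (b x) := by
              rw [← ENNReal.ofReal_mul (by positivity), one_div_mul_cancel hx.ne']; simp
          _ ≤ D * ENNReal.ofReal (b x) := by gcongr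
      _ = D • weightedMeasure Ω b := withDensity_smul' _ _ hD
  · intro h
    refine h.of_measure_le_smul hC ?_
    calc weightedMeasure Ω b ≤ volume.withDensity (C • (1 : Ω → ℝ≥0∞)) := by
          refine withDensity_mono ?_
          filter_upwards [hCb] with x hx
          simpa using hx
      _ = C • volume := by rw [withDensity_smul' _ _ hC, withDensity_one]

end TVFlow

end

/-! ### Normal vectors to a closed convex set and the implicit Euler step -/

noncomputable section

namespace ConvexFlow

open Filter

variable {H : Type*} [NormedAddCommGroup H] [InnerProductSpace ℝ H]

/-! On `L²_b(Ω)` the functional `TV_a` is a supremum of continuous linear functionals, `E(v) = sup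
⟪v, f⟫` over `f = -div φ / b` with `φ` admissible (`energy_eq_iSup`). It is therefore nonnegative,
convex and positively 1-homogeneous, and everything about its flow can be read off the closed convex
set `K = ∂E(0)`: `f ∈ ∂E(y)` as soon as `f ∈ K` is an outward normal at which `⟪y, ·⟫` attains its
maximum over `K`. An implicit Euler step is then a projection onto `K`.

Existence: Euler steps are nonexpansive, and Kobayashi's estimate makes the schemes Cauchy as the
step tends to `0`, for initial data in the closure of `D(E)`. Homogeneity bounds the speed of the
limit by `2‖x‖ / t`, so weak compactness in `L²` produces a time derivative on each `(δ, ∞)`. At a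
point of differentiability, difference quotients lie in `-K` and the energy inequality makes `-u'`
normal to `K`, hence a subgradient (`isNormal_flow`).

Uniqueness: the subdifferential is monotone, so the distance of two solutions does not increase
(`norm_sub_le_of_isGradientFlow`).

If `a` is locally integrable, every function with bounded, compactly supported gradient has finite
energy. Such functions span a dense subspace, by the fundamental lemma of the calculus of variations
on a domain and by Stone–Weierstrass on a torus, so every initial datum is allowed
(`closure_effectiveDomain_eq_univ`). -/

/-- A closed convex set containing the origin: the subdifferential at the origin of a nonnegative
convex positively homogeneous functional. -/
structure IsDualSet (K : Set H) : Prop where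
  convex : Convex ℝ K
  isClosed : IsClosed K
  zero_mem : (0 : H) ∈ K

/-- `y` is an outward normal to `K` at `f`; equivalently, `f` is a subgradient at `y` of the support
function of `K`. -/
def IsNormal (K : Set H) (y f : H) : Prop := f ∈ K ∧ ∀ k ∈ K, inner ℝ y (k - f) ≤ 0

/-- The Yosida approximation: the projection of `h⁻¹ • x` onto `K`. -/
def yosida (K : Set H) (h : ℝ) (x : H) : H :=
  Classical.epsilon fun f => IsNormal K (x - h • f) f

/-- One implicit Euler step of size `h`. -/
def resolvent (K : Set H) (h : ℝ) (x : H) : H := x - h • yosida K h x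

variable {K : Set H}

/-- The variational inequality of the projection of `h⁻¹ • x` onto `K`, multiplied by `h`. -/
theorem exists_isNormal [CompleteSpace H] (hK : IsDualSet K) {h : ℝ} (hh : 0 < h) (x : H) :
    ∃ f, IsNormal K (x - h • f) f := by
  obtain ⟨f, hf, hmin⟩ := exists_norm_eq_iInf_of_complete_convex ⟨0, hK.zero_mem⟩
    hK.isClosed.isComplete hK.convex (h⁻¹ • x)
  refine ⟨f, hf, fun k hk => ?_⟩
  have := (norm_eq_iInf_iff_real_inner_le_zero hK.convex hf).1 hmin k hk
  have e : x - h • f = h • (h⁻¹ • x - f) := by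
    rw [smul_sub, smul_inv_smul₀ hh.ne']
  rw [e, real_inner_smul_left]
  exact mul_nonpos_of_nonneg_of_nonpos hh.le this

theorem isNormal_resolvent [CompleteSpace H] (hK : IsDualSet K) {h : ℝ} (hh : 0 < h) (x : H) :
    IsNormal K (resolvent K h x) (yosida K h x) :=
  Classical.epsilon_spec (exists_isNormal hK hh x)

theorem resolvent_add_smul_yosida (h : ℝ) (x : H) :
    resolvent K h x + h • yosida K h x = x := sub_add_cancel _ _

theorem IsNormal.inner_sub_nonneg {y f y' f' : H} (h : IsNormal K y f) (h' : IsNormal K y' f') :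
    0 ≤ inner ℝ (y - y') (f - f') := by
  have h1 := h.2 f' h'.1
  have h2 := h'.2 f h.1
  simp only [inner_sub_left, inner_sub_right] at *
  linarith

/-- Expanding the square on the right, the cross term is nonnegative by monotonicity. Both
uniqueness and nonexpansiveness of the Euler step follow. -/
theorem IsNormal.norm_sub_le {y f y' f' : H} (hn : IsNormal K y f) (hn' : IsNormal K y' f')
    {h : ℝ} (hh : 0 ≤ h) : ‖y - y'‖ ≤ ‖(y + h • f) - (y' + h • f')‖ := by
  have e : (y + h • f) - (y' + h • f') = (y - y') + h • (f - f') := by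
    rw [smul_sub]; abel
  have := hn.inner_sub_nonneg hn'
  rw [e]
  refine le_of_sq_le_sq ?_ (norm_nonneg _)
  rw [norm_add_sq_real, real_inner_smul_right]
  nlinarith [mul_nonneg hh this, sq_nonneg ‖h • (f - f')‖]

variable [CompleteSpace H]

theorem IsNormal.resolvent_eq (hK : IsDualSet K) {y f : H} (hn : IsNormal K y f) {h : ℝ}
    (hh : 0 < h) : resolvent K h (y + h • f) = y := by
  have := (isNormal_resolvent hK hh (y + h • f)).norm_sub_le hn hh.le
  rw [resolvent_add_smul_yosida, sub_self, norm_zero] at this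
  exact sub_eq_zero.1 (norm_le_zero_iff.1 this)

theorem norm_resolvent_sub_le (hK : IsDualSet K) {h : ℝ} (hh : 0 < h) (x x' : H) :
    ‖resolvent K h x - resolvent K h x'‖ ≤ ‖x - x'‖ := by
  have := (isNormal_resolvent hK hh x).norm_sub_le (isNormal_resolvent hK hh x') hh.le
  rwa [resolvent_add_smul_yosida, resolvent_add_smul_yosida] at this

theorem resolvent_zero (hK : IsDualSet K) {h : ℝ} (hh : 0 < h) : resolvent K h 0 = 0 := by
  have : IsNormal K 0 0 := ⟨hK.zero_mem, fun k _ => by simp⟩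
  simpa using this.resolvent_eq hK hh

/-- A normal direction may be rescaled while `f` stays fixed. This homogeneity is the source of the
regularizing effect. -/
theorem resolvent_smul (hK : IsDualSet K) {h c : ℝ} (hh : 0 < h) (hc : 0 < c) (x : H) :
    resolvent K (c * h) (c • x) = c • resolvent K h x := by
  have hn := isNormal_resolvent hK hh x
  have hn' : IsNormal K (c • resolvent K h x) (yosida K h x) := by
    refine ⟨hn.1, fun k hk => ?_⟩
    rw [real_inner_smul_left]
    exact mul_nonpos_of_nonneg_of_nonpos hc.le (hn.2 k hk)
  have := hn'.resolvent_eq hK (mul_pos hc hh)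
  rwa [mul_smul, ← smul_add, resolvent_add_smul_yosida] at this

/-- The pair `(resolvent K h x, yosida K h x)` is normal whatever the step, and the argument on the
left is the first entry plus `μ` times the second. -/
theorem resolvent_identity (hK : IsDualSet K) {h μ : ℝ} (hh : 0 < h) (hμ : 0 < μ) (x : H) :
    resolvent K μ ((μ / h) • x + (1 - μ / h) • resolvent K h x) = resolvent K h x := by
  convert (isNormal_resolvent hK hh x).resolvent_eq hK hμ using 2
  nth_rewrite 1 [← resolvent_add_smul_yosida (K := K) h x]
  rw [smul_add, smul_smul, div_mul_cancel₀ _ hh.ne', sub_smul, one_smul]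
  abel

/-- Every implicit Euler step from `x` has speed at most `L`. -/
def SpeedLE (K : Set H) (x : H) (L : ℝ) : Prop := ∀ h, 0 < h → ‖x - resolvent K h x‖ ≤ h * L

omit [CompleteSpace H] in
theorem SpeedLE.nonneg {x : H} {L : ℝ} (hx : SpeedLE K x L) : 0 ≤ L := by
  simpa using (norm_nonneg _).trans (hx 1 one_pos)

/-- With `y` the resolvent and `f` the Yosida approximation, `y` is also the `μ`-step from `y + μ •
f`; nonexpansiveness does the rest. This supplies enough points of bounded speed. -/
theorem speedLE_resolvent (hK : IsDualSet K) {h : ℝ} (hh : 0 < h) (x : H) :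
    SpeedLE K (resolvent K h x) ‖yosida K h x‖ := by
  intro μ hμ
  have hn := isNormal_resolvent hK hh x
  have := norm_resolvent_sub_le hK hμ (resolvent K h x + μ • yosida K h x) (resolvent K h x)
  rwa [hn.resolvent_eq hK hμ, add_sub_cancel_left, norm_smul, Real.norm_of_nonneg hμ.le] at this

/-! ### Iterated Euler steps -/

theorem norm_iterate_sub_le (hK : IsDualSet K) {h : ℝ} (hh : 0 < h) (x x' : H) (n : ℕ) :
    ‖(resolvent K h)^[n] x - (resolvent K h)^[n] x'‖ ≤ ‖x - x'‖ := by
  induction n with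
  | zero => simp
  | succ n ih =>
    rw [Function.iterate_succ_apply', Function.iterate_succ_apply']
    exact (norm_resolvent_sub_le hK hh _ _).trans ih

theorem norm_iterate_le (hK : IsDualSet K) {h : ℝ} (hh : 0 < h) (x : H) (n : ℕ) :
    ‖(resolvent K h)^[n] x‖ ≤ ‖x‖ := by
  have := norm_iterate_sub_le hK hh x 0 n
  rwa [Function.iterate_fixed (resolvent_zero hK hh), sub_zero, sub_zero] at this

theorem iterate_smul (hK : IsDualSet K) {h c : ℝ} (hh : 0 < h) (hc : 0 < c) (x : H) (n : ℕ) :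
    (resolvent K (c * h))^[n] (c • x) = c • (resolvent K h)^[n] x := by
  induction n with
  | zero => simp
  | succ n ih =>
    rw [Function.iterate_succ_apply', Function.iterate_succ_apply', ih, resolvent_smul hK hh hc]

theorem norm_sub_iterate_le (hK : IsDualSet K) {h L : ℝ} (hh : 0 < h) {x : H}
    (hx : SpeedLE K x L) (n : ℕ) : ‖x - (resolvent K h)^[n] x‖ ≤ n * h * L := by
  induction n with
  | zero => simp
  | succ n ih =>
    have h1 := norm_iterate_sub_le hK hh x (resolvent K h x) n
    rw [← Function.iterate_succ_apply] at h1
    calc ‖x - (resolvent K h)^[n + 1] x‖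
        ≤ ‖x - (resolvent K h)^[n] x‖ + ‖(resolvent K h)^[n] x - (resolvent K h)^[n + 1] x‖ :=
          norm_sub_le_norm_sub_add_norm_sub _ _ _
      _ ≤ n * h * L + h * L := add_le_add ih (h1.trans (hx h hh))
      _ = _ := by push_cast; ring

theorem norm_iterate_sub_iterate_add_le (hK : IsDualSet K) {h L : ℝ} (hh : 0 < h) {x : H}
    (hx : SpeedLE K x L) (m n : ℕ) :
    ‖(resolvent K h)^[m] x - (resolvent K h)^[m + n] x‖ ≤ n * h * L := by
  rw [Function.iterate_add_apply]
  exact (norm_iterate_sub_le hK hh _ _ _).trans (norm_sub_iterate_le hK hh hx n)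

/-- **Kobayashi's estimate** comparing implicit Euler schemes with different step sizes. -/
theorem norm_iterate_sub_iterate_le (hK : IsDualSet K) {h μ L : ℝ} (hμ : 0 < μ) (hμh : μ ≤ h)
    {x : H} (hx : SpeedLE K x L) (m n : ℕ) :
    ‖(resolvent K h)^[m] x - (resolvent K μ)^[n] x‖ ≤
      L * √((m * h - n * μ) ^ 2 + m * h ^ 2 + n * μ ^ 2) := by
  have hh : 0 < h := hμ.trans_le hμh
  have hL := hx.nonneg
  induction n generalizing m with
  | zero =>
    rw [norm_sub_rev, Function.iterate_zero_apply]
    refine (norm_sub_iterate_le hK hh hx m).trans ?_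
    rw [mul_comm]
    refine mul_le_mul_of_nonneg_left (Real.le_sqrt_of_sq_le ?_) hL
    have : 0 ≤ (m : ℝ) * h ^ 2 := by positivity
    simp only [Nat.cast_zero]
    linarith
  | succ n ih =>
    cases m with
    | zero =>
      rw [Function.iterate_zero_apply]
      refine (norm_sub_iterate_le hK hμ hx (n + 1)).trans ?_
      rw [mul_comm]
      refine mul_le_mul_of_nonneg_left (Real.le_sqrt_of_sq_le ?_) hL
      have : 0 ≤ ((n + 1 : ℕ) : ℝ) * μ ^ 2 := by positivity
      simp only [Nat.cast_zero]
      linarith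
    | succ m =>
      -- By the resolvent identity `y'` is the `μ`-step from `α • y + (1 - α) • y'`, a convex
      -- combination because `μ ≤ h`. The error at `(m + 1, n + 1)` is thus averaged from those at
      -- `(m, n)` and `(m + 1, n)`.
      set α := μ / h with hα
      have hα0 : 0 ≤ α := by positivity
      have hα1 : 0 ≤ 1 - α := sub_nonneg.2 ((div_le_one hh).2 hμh)
      have hαh : α * h = μ := div_mul_cancel₀ _ hh.ne'
      set y := (resolvent K h)^[m] x
      set y' := (resolvent K h)^[m + 1] x with hy'
      set z := (resolvent K μ)^[n] x
      have ey : y' = resolvent K h y := Function.iterate_succ_apply' _ _ _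
      have h1 : ‖y' - resolvent K μ z‖ ≤ α * ‖y - z‖ + (1 - α) * ‖y' - z‖ := by
        have e := resolvent_identity hK hh hμ y
        rw [← ey, ← hα] at e
        calc ‖y' - resolvent K μ z‖ ≤ ‖(α • y + (1 - α) • y') - z‖ := by
              nth_rewrite 1 [← e]
              exact norm_resolvent_sub_le hK hμ _ _
          _ = ‖α • (y - z) + (1 - α) • (y' - z)‖ := by
              congr 1; module
          _ ≤ _ := by
              refine (norm_add_le _ _).trans_eq ?_
              rw [norm_smul, norm_smul, Real.norm_of_nonneg hα0, Real.norm_of_nonneg hα1]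
      rw [Function.iterate_succ_apply']
      refine h1.trans ?_
      have i1 := ih m
      have i2 := ih (m + 1)
      set p := (m * h - n * μ) ^ 2 + m * h ^ 2 + n * μ ^ 2 with hp
      set q := (((m + 1 : ℕ) : ℝ) * h - n * μ) ^ 2 + ((m + 1 : ℕ) : ℝ) * h ^ 2 + n * μ ^ 2 with hq
      have hp0 : 0 ≤ p := by positivity
      have hq0 : 0 ≤ q := by positivity
      have conc : α * √p + (1 - α) * √q ≤ √(α * p + (1 - α) * q) :=
        Real.strictConcaveOn_sqrt.concaveOn.2 hp0 hq0 hα0 hα1 (by ring)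
      calc α * ‖y - z‖ + (1 - α) * ‖y' - z‖
          ≤ α * (L * √p) + (1 - α) * (L * √q) :=
            add_le_add (mul_le_mul_of_nonneg_left i1 hα0) (mul_le_mul_of_nonneg_left i2 hα1)
        _ = L * (α * √p + (1 - α) * √q) := by ring
        _ ≤ L * √(α * p + (1 - α) * q) := mul_le_mul_of_nonneg_left conc hL
        _ ≤ _ := by
          refine mul_le_mul_of_nonneg_left (Real.sqrt_le_sqrt ?_) hL
          rw [hp, hq, ← hαh]
          push_cast
          -- Since `α * h = μ`, the target exceeds the convex combination by exactly `2 * μ ^ 2`.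
          have : 0 ≤ (α * h) ^ 2 := sq_nonneg _
          nlinarith [this]

/-- `f` is the mean of the Yosida approximations over the `n` steps, which convexity keeps in `K`.
In this form the information survives the limit, `K` being closed. -/
theorem exists_mem_iterate_sub (hK : IsDualSet K) {h : ℝ} (hh : 0 < h) (x : H) (m n : ℕ) :
    ∃ f ∈ K, (resolvent K h)^[m] x - (resolvent K h)^[m + n] x = (n * h) • f := by
  induction n with
  | zero => exact ⟨0, hK.zero_mem, by simp⟩
  | succ n ih =>
    obtain ⟨f, hf, e⟩ := ih
    set y := (resolvent K h)^[m + n] x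
    have hn := (isNormal_resolvent hK hh y).1
    have e2 : (resolvent K h)^[m + (n + 1)] x = resolvent K h y :=
      Function.iterate_succ_apply' _ (m + n) _
    refine ⟨((n : ℝ) / (n + 1)) • f + ((1 : ℝ) / (n + 1)) • yosida K h y,
      hK.convex hf hn (by positivity) (by positivity) (by field_simp), ?_⟩
    have e3 : y - resolvent K h y = h • yosida K h y := sub_sub_cancel _ _
    rw [e2, ← sub_add_sub_cancel _ y, e, e3, smul_add, smul_smul, smul_smul]
    congr 2 <;> · push_cast; field_simp

/-- A step from `y` to `w` along `f` lowers half the squared norm by at least `h * ⟪w, f⟫ ≥ h * ⟪w,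
k⟫`. Replacing each `w` by the last iterate costs at most `‖k‖ * (n * h * L)`, by the speed bound,
and avoids a Riemann sum in the limit. -/
theorem le_iterate_energy (hK : IsDualSet K) {h L : ℝ} (hh : 0 < h) {x : H}
    (hx : SpeedLE K x L) {k : H} (hk : k ∈ K) (m n : ℕ) :
    n * h * (inner ℝ ((resolvent K h)^[m + n] x) k - ‖k‖ * (n * h * L)) ≤
      ‖(resolvent K h)^[m] x‖ ^ 2 / 2 - ‖(resolvent K h)^[m + n] x‖ ^ 2 / 2 := by
  -- The induction is on the number of steps taken, with the last iterate `m + n` held fixed.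
  have key : ∀ j ≤ n, j * h * (inner ℝ ((resolvent K h)^[m + n] x) k - ‖k‖ * (n * h * L)) ≤
      ‖(resolvent K h)^[m] x‖ ^ 2 / 2 - ‖(resolvent K h)^[m + j] x‖ ^ 2 / 2 := by
    intro j
    induction j with
    | zero => simp
    | succ j ih =>
      intro hj
      have h1 := ih (by omega)
      obtain ⟨l, rfl⟩ := Nat.exists_eq_add_of_le hj
      set y := (resolvent K h)^[m + j] x
      have e2 : (resolvent K h)^[m + (j + 1)] x = resolvent K h y :=
        Function.iterate_succ_apply' _ (m + j) _
      have hd := norm_iterate_sub_iterate_add_le hK hh hx (m + (j + 1)) l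
      rw [e2, add_assoc] at hd
      set z := (resolvent K h)^[m + (j + 1 + l)] x
      rw [e2]
      have hn := (isNormal_resolvent hK hh y).2 k hk
      have e3 : y = resolvent K h y + h • yosida K h y := (resolvent_add_smul_yosida h y).symm
      set w := resolvent K h y
      set f := yosida K h y
      have hL := hx.nonneg
      have h2 : ‖y‖ ^ 2 = ‖w‖ ^ 2 + 2 * (h * inner ℝ w f) + ‖h • f‖ ^ 2 := by
        rw [e3, norm_add_sq_real, real_inner_smul_right]
      have h3 : inner ℝ z k - ‖k‖ * (((j + 1 + l : ℕ) : ℝ) * h * L) ≤ inner ℝ w k := by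
        have a1 : inner ℝ (z - w) k ≤ ‖z - w‖ * ‖k‖ := real_inner_le_norm _ _
        rw [norm_sub_rev] at a1
        have a2 : ‖w - z‖ * ‖k‖ ≤ (((j + 1 + l : ℕ) : ℝ) * h * L) * ‖k‖ := by
          refine mul_le_mul_of_nonneg_right (hd.trans ?_) (norm_nonneg _)
          push_cast
          have : 0 ≤ ((j : ℝ) + 1) * h * L := by positivity
          linarith
        rw [inner_sub_left] at a1
        linarith
      have h4 : inner ℝ w k ≤ inner ℝ w f := by
        rw [inner_sub_right] at hn; linarith
      have h5 := mul_le_mul_of_nonneg_left (h3.trans h4) hh.le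
      push_cast at h1 h5 ⊢
      nlinarith [sq_nonneg ‖h • f‖]
  exact key n le_rfl

end ConvexFlow
end

noncomputable section

namespace ConvexFlow

open Filter

variable {H : Type*} [NormedAddCommGroup H] [InnerProductSpace ℝ H] {K : Set H}

/-! ### The limit of the implicit Euler scheme -/

/-- The implicit Euler approximation with step `h`, at time `t`. -/
def euler (K : Set H) (h : ℝ) (x : H) (t : ℝ) : H := (resolvent K h)^[⌊t / h⌋₊] x

/-- The flow generated by the implicit Euler scheme; it is constant for negative times. -/
def flow (K : Set H) (x : H) (t : ℝ) : H :=
  haveI : Nonempty H := ⟨0⟩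
  limUnder (𝓝[>] (0 : ℝ)) fun h => euler K h x t

/-- The initial data from which the flow is constructed. -/
def flowDomain (K : Set H) : Set H := closure {x | ∃ L, SpeedLE K x L}

theorem floor_div_mul_le {t h : ℝ} (hh : 0 < h) : ⌊t / h⌋₊ * h ≤ max t 0 := by
  rcases le_total 0 t with ht | ht
  · refine le_trans ?_ (le_max_left _ _)
    exact (le_div_iff₀ hh).1 (Nat.floor_le (div_nonneg ht hh.le))
  · rw [Nat.floor_of_nonpos (div_nonpos_of_nonpos_of_nonneg ht hh.le)]
    simp

theorem lt_floor_div_mul {t h : ℝ} (hh : 0 < h) : max t 0 - h < ⌊t / h⌋₊ * h := by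
  have h1 := (div_lt_iff₀ hh).1 (Nat.lt_floor_add_one (t / h))
  have h2 : 0 ≤ (⌊t / h⌋₊ : ℝ) * h := by positivity
  rcases le_total 0 t with ht | ht
  · rw [max_eq_left ht]; linarith
  · rw [max_eq_right ht]; linarith

theorem tendsto_floor_div_mul (t : ℝ) :
    Tendsto (fun h : ℝ => ⌊t / h⌋₊ * h) (𝓝[>] 0) (𝓝 (max t 0)) := by
  have h1 : Tendsto (fun h : ℝ => max t 0 - h) (𝓝[>] 0) (𝓝 (max t 0)) := by
    refine Tendsto.mono_left ?_ nhdsWithin_le_nhds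
    exact (continuous_const.sub continuous_id).tendsto' _ _ (by simp)
  refine tendsto_of_tendsto_of_tendsto_of_le_of_le' h1 tendsto_const_nhds ?_ ?_
  · filter_upwards [self_mem_nhdsWithin] with h hh using (lt_floor_div_mul hh).le
  · filter_upwards [self_mem_nhdsWithin] with h hh using floor_div_mul_le hh

variable [CompleteSpace H]

theorem norm_euler_sub_le (hK : IsDualSet K) {h : ℝ} (hh : 0 < h) (x x' : H) (t : ℝ) :
    ‖euler K h x t - euler K h x' t‖ ≤ ‖x - x'‖ :=
  norm_iterate_sub_le hK hh x x' _

/-- In Kobayashi's estimate the two grid times differ by at most `h`, and each of the two other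
terms is at most `max t 0 * h`. -/
theorem norm_euler_sub_euler_le (hK : IsDualSet K) {h μ L : ℝ} (hμ : 0 < μ) (hμh : μ ≤ h) {x : H}
    (hx : SpeedLE K x L) (t : ℝ) :
    ‖euler K h x t - euler K μ x t‖ ≤ L * √(h ^ 2 + 2 * max t 0 * h) := by
  have hh := hμ.trans_le hμh
  refine (norm_iterate_sub_iterate_le hK hμ hμh hx _ _).trans ?_
  refine mul_le_mul_of_nonneg_left (Real.sqrt_le_sqrt ?_) hx.nonneg
  have a1 := floor_div_mul_le (t := t) hh
  have a2 := lt_floor_div_mul (t := t) hh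
  have b1 := floor_div_mul_le (t := t) hμ
  have b2 := lt_floor_div_mul (t := t) hμ
  set p := (⌊t / h⌋₊ : ℝ) * h
  set q := (⌊t / μ⌋₊ : ℝ) * μ
  have e1 : (⌊t / h⌋₊ : ℝ) * h ^ 2 = p * h := by ring
  have e2 : (⌊t / μ⌋₊ : ℝ) * μ ^ 2 = q * μ := by ring
  rw [e1, e2]
  have c1 : (p - q) ^ 2 ≤ h ^ 2 := sq_le_sq' (by linarith) (by linarith)
  have c2 : p * h ≤ max t 0 * h := mul_le_mul_of_nonneg_right a1 hh.le
  have c3 : q * μ ≤ max t 0 * h := mul_le_mul b1 hμh hμ.le (le_max_right _ _)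
  linarith

/-- For data of bounded speed the previous estimate gives the Cauchy property; nonexpansiveness
extends it to the closure by an `ε / 3` argument. -/
theorem tendsto_euler (hK : IsDualSet K) {x : H} (hx : x ∈ flowDomain K) (t : ℝ) :
    Tendsto (fun h => euler K h x t) (𝓝[>] 0) (𝓝 (flow K x t)) := by
  refine tendsto_nhds_limUnder (cauchy_map_iff_exists_tendsto.1 (Metric.cauchy_iff.2
    ⟨inferInstance, fun ε hε => ?_⟩))
  obtain ⟨x', ⟨L, hL⟩, hxx'⟩ := Metric.mem_closure_iff.1 hx (ε / 3) (by positivity)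
  rw [dist_eq_norm] at hxx'
  have hlim : Tendsto (fun h : ℝ => L * √(h ^ 2 + 2 * max t 0 * h)) (𝓝[>] 0) (𝓝 0) := by
    refine Tendsto.mono_left ?_ nhdsWithin_le_nhds
    exact Continuous.tendsto' (by fun_prop) _ _ (by simp)
  have hev := (hlim.eventually (gt_mem_nhds (show (0 : ℝ) < ε / 3 by positivity))).and
    self_mem_nhdsWithin
  refine ⟨_, image_mem_map hev, ?_⟩
  have main : ∀ h μ : ℝ, 0 < μ → μ ≤ h → L * √(h ^ 2 + 2 * max t 0 * h) < ε / 3 →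
      dist (euler K h x t) (euler K μ x t) < ε := by
    intro h μ hμ hμh hlt
    have hh := hμ.trans_le hμh
    rw [dist_eq_norm]
    have h1 := norm_euler_sub_le hK hh x x' t
    have h2 := norm_euler_sub_euler_le hK hμ hμh hL t
    have h3 := norm_euler_sub_le hK hμ x' x t
    rw [norm_sub_rev x' x] at h3
    have h4 := norm_sub_le_norm_sub_add_norm_sub (euler K h x t) (euler K h x' t) (euler K μ x t)
    have h5 := norm_sub_le_norm_sub_add_norm_sub (euler K h x' t) (euler K μ x' t) (euler K μ x t)
    linarith
  rintro _ ⟨h, ⟨h1, h2⟩, rfl⟩ _ ⟨μ, ⟨h3, h4⟩, rfl⟩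
  rcases le_total μ h with hle | hle
  · exact main h μ h4 hle h1
  · rw [dist_comm]; exact main μ h h2 hle h3

theorem flow_of_nonpos (hK : IsDualSet K) {x : H} (hx : x ∈ flowDomain K) {t : ℝ} (ht : t ≤ 0) :
    flow K x t = x := by
  refine tendsto_nhds_unique (tendsto_euler hK hx t) (tendsto_const_nhds.congr' ?_)
  filter_upwards [self_mem_nhdsWithin] with h (hh : 0 < h)
  rw [euler, Nat.floor_of_nonpos (div_nonpos_of_nonpos_of_nonneg ht hh.le)]
  rfl

theorem norm_flow_sub_le (hK : IsDualSet K) {x x' : H} (hx : x ∈ flowDomain K)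
    (hx' : x' ∈ flowDomain K) (t : ℝ) : ‖flow K x t - flow K x' t‖ ≤ ‖x - x'‖ := by
  refine le_of_tendsto ((tendsto_euler hK hx t).sub (tendsto_euler hK hx' t)).norm ?_
  filter_upwards [self_mem_nhdsWithin] with h hh using norm_euler_sub_le hK hh x x' t

/-- The regularizing effect: it comes from the homogeneity of the scheme. -/
theorem norm_flow_sub_flow_le (hK : IsDualSet K) {x : H} (hx : x ∈ flowDomain K) {s t : ℝ}
    (hs : 0 < s) (hst : s ≤ t) : ‖flow K x t - flow K x s‖ ≤ 2 * ‖x‖ / s * (t - s) := by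
  set c := t / s
  have hc : 1 ≤ c := (one_le_div hs).2 hst
  have hc0 : 0 < c := one_pos.trans_le hc
  have hm : Tendsto (fun μ : ℝ => c * μ) (𝓝[>] 0) (𝓝[>] 0) := by
    refine tendsto_nhdsWithin_iff.2 ⟨?_, ?_⟩
    · refine Tendsto.mono_left ?_ nhdsWithin_le_nhds
      exact Continuous.tendsto' (by fun_prop) _ _ (by simp)
    · filter_upwards [self_mem_nhdsWithin] with μ hμ using mul_pos hc0 hμ
  refine le_of_tendsto (((tendsto_euler hK hx t).comp hm).sub (tendsto_euler hK hx s)).norm ?_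
  filter_upwards [self_mem_nhdsWithin] with μ (hμ : 0 < μ)
  -- As `t / (c * μ) = s / μ`, both schemes take the same number of steps, so homogeneity applies.
  -- Changing the datum from `x` to `c • x` and rescaling the result each cost `(c - 1) * ‖x‖`,
  -- whence the factor `2`.
  have e : euler K (c * μ) (c • x) t = c • euler K μ x s := by
    have : t / (c * μ) = s / μ := by
      rw [← div_mul_cancel₀ t hs.ne', mul_div_mul_left _ _ hc0.ne']
    rw [euler, euler, this, iterate_smul hK hμ hc0]
  have h1 := norm_euler_sub_le hK (mul_pos hc0 hμ) x (c • x) t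
  have hsub : ∀ v : H, c • v - v = (c - 1) • v := fun v => by rw [sub_smul, one_smul]
  have h2 : ‖x - c • x‖ = (c - 1) * ‖x‖ := by
    rw [norm_sub_rev, hsub, norm_smul, Real.norm_of_nonneg (by linarith)]
  have h3 : ‖c • euler K μ x s - euler K μ x s‖ ≤ (c - 1) * ‖x‖ := by
    rw [hsub, norm_smul, Real.norm_of_nonneg (by linarith)]
    exact mul_le_mul_of_nonneg_left (norm_iterate_le hK hμ x _) (by linarith)
  have h4 := norm_sub_le_norm_sub_add_norm_sub (euler K (c * μ) x t) (c • euler K μ x s)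
    (euler K μ x s)
  rw [e, h2] at h1
  have h5 : 2 * ‖x‖ / s * (t - s) = 2 * ((c - 1) * ‖x‖) := by
    simp only [c]; field_simp
  simp only [Function.comp_apply]
  linarith

theorem floor_div_mono {s t h : ℝ} (hh : 0 < h) (hst : s ≤ t) : ⌊s / h⌋₊ ≤ ⌊t / h⌋₊ :=
  Nat.floor_mono (div_le_div_of_nonneg_right hst hh.le)

theorem tendsto_floor_sub_mul {s t : ℝ} (hs : 0 ≤ s) (hst : s ≤ t) :
    Tendsto (fun h : ℝ => ((⌊t / h⌋₊ - ⌊s / h⌋₊ : ℕ) : ℝ) * h) (𝓝[>] 0) (𝓝 (t - s)) := by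
  have := (tendsto_floor_div_mul t).sub (tendsto_floor_div_mul s)
  rw [max_eq_left hs, max_eq_left (hs.trans hst)] at this
  refine this.congr' ?_
  filter_upwards [self_mem_nhdsWithin] with h hh
  rw [Nat.cast_sub (floor_div_mono hh hst)]
  ring

theorem inv_smul_flow_sub_mem (hK : IsDualSet K) {x : H} (hx : x ∈ flowDomain K) {s t : ℝ}
    (hs : 0 ≤ s) (hst : s < t) : (t - s)⁻¹ • (flow K x s - flow K x t) ∈ K := by
  have h1 := ((tendsto_floor_sub_mul hs hst.le).inv₀ (sub_pos.2 hst).ne').smul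
    ((tendsto_euler hK hx s).sub (tendsto_euler hK hx t))
  refine hK.isClosed.mem_of_tendsto h1 ?_
  filter_upwards [self_mem_nhdsWithin] with h (hh : 0 < h)
  obtain ⟨f, hf, e⟩ := exists_mem_iterate_sub hK hh x ⌊s / h⌋₊ (⌊t / h⌋₊ - ⌊s / h⌋₊)
  rw [Nat.add_sub_cancel' (floor_div_mono hh hst.le)] at e
  rw [euler, euler, e, smul_smul]
  -- If both times lie in one grid cell, the scalar is `0⁻¹ = 0` and the vector is `0 ∈ K`.
  rcases eq_or_ne (((⌊t / h⌋₊ - ⌊s / h⌋₊ : ℕ) : ℝ) * h) 0 with h0 | h0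
  · rw [h0]; simpa using hK.zero_mem
  · rwa [inv_mul_cancel₀ h0, one_smul]

theorem SpeedLE.norm_flow_sub_le (hK : IsDualSet K) {x : H} {L : ℝ} (hx : SpeedLE K x L) {s t : ℝ}
    (hs : 0 ≤ s) (hst : s ≤ t) : ‖flow K x s - flow K x t‖ ≤ (t - s) * L := by
  have hx' : x ∈ flowDomain K := subset_closure ⟨L, hx⟩
  refine le_of_tendsto_of_tendsto ((tendsto_euler hK hx' s).sub (tendsto_euler hK hx' t)).norm
    ((tendsto_floor_sub_mul hs hst).mul_const L) ?_
  filter_upwards [self_mem_nhdsWithin] with h (hh : 0 < h)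
  have := norm_iterate_sub_iterate_add_le hK hh hx ⌊s / h⌋₊ (⌊t / h⌋₊ - ⌊s / h⌋₊)
  rwa [Nat.add_sub_cancel' (floor_div_mono hh hst)] at this

theorem flow_max_zero (hK : IsDualSet K) {x : H} (hx : x ∈ flowDomain K) (t : ℝ) :
    flow K x (max t 0) = flow K x t := by
  rcases le_total 0 t with ht | ht
  · rw [max_eq_left ht]
  · rw [max_eq_right ht, flow_of_nonpos hK hx le_rfl, flow_of_nonpos hK hx ht]

theorem SpeedLE.continuous_flow (hK : IsDualSet K) {x : H} {L : ℝ} (hx : SpeedLE K x L) :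
    Continuous (flow K x) := by
  have hx' : x ∈ flowDomain K := subset_closure ⟨L, hx⟩
  have key : ∀ s t, s ≤ t → ‖flow K x s - flow K x t‖ ≤ L * |s - t| := by
    intro s t hst
    rw [← flow_max_zero hK hx' s, ← flow_max_zero hK hx' t]
    refine (hx.norm_flow_sub_le hK (le_max_right _ _) (max_le_max_right 0 hst)).trans ?_
    rw [mul_comm]
    refine mul_le_mul_of_nonneg_left ?_ hx.nonneg
    refine (le_abs_self _).trans ?_
    rw [abs_sub_comm s t]
    exact abs_max_sub_max_le_abs _ _ _
  refine (LipschitzWith.of_dist_le_mul (K := ⟨L, hx.nonneg⟩) fun s t => ?_).continuous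
  rw [dist_eq_norm, Real.dist_eq]
  rcases le_total s t with h | h
  · exact key s t h
  · rw [norm_sub_rev, abs_sub_comm]; exact key t s h

theorem continuous_flow (hK : IsDualSet K) {x : H} (hx : x ∈ flowDomain K) :
    Continuous (flow K x) := by
  refine continuous_of_uniform_approx_of_continuous fun u hu => ?_
  obtain ⟨ε, hε, hεu⟩ := Metric.mem_uniformity_dist.1 hu
  obtain ⟨x', ⟨L, hL⟩, hxx'⟩ := Metric.mem_closure_iff.1 hx ε hε
  refine ⟨flow K x', hL.continuous_flow hK, fun t => hεu ?_⟩
  rw [dist_eq_norm] at hxx' ⊢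
  exact (norm_flow_sub_le hK hx (subset_closure ⟨L, hL⟩) t).trans_lt hxx'

/-! ### The energy inequality for the flow -/

theorem SpeedLE.le_flow_energy (hK : IsDualSet K) {x : H} {L : ℝ} (hx : SpeedLE K x L) {s t : ℝ}
    (hs : 0 ≤ s) (hst : s ≤ t) {k : H} (hk : k ∈ K) :
    (t - s) * (inner ℝ (flow K x t) k - ‖k‖ * ((t - s) * L)) ≤
      ‖flow K x s‖ ^ 2 / 2 - ‖flow K x t‖ ^ 2 / 2 := by
  have hx' : x ∈ flowDomain K := subset_closure ⟨L, hx⟩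
  have hd := tendsto_floor_sub_mul hs hst
  have ls := tendsto_euler hK hx' s
  have lt := tendsto_euler hK hx' t
  refine le_of_tendsto_of_tendsto (hd.mul ((lt.inner tendsto_const_nhds).sub
    ((hd.mul_const L).const_mul ‖k‖)))
    (((ls.norm.pow 2).div_const 2).sub ((lt.norm.pow 2).div_const 2)) ?_
  filter_upwards [self_mem_nhdsWithin] with h (hh : 0 < h)
  have := le_iterate_energy hK hh hx hk ⌊s / h⌋₊ (⌊t / h⌋₊ - ⌊s / h⌋₊)
  rwa [Nat.add_sub_cancel' (floor_div_mono hh hst)] at this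

/-- If the increments of `ψ` over short intervals are at most an arbitrarily small multiple of those
of a fixed function, then `ψ` does not increase. -/
theorem le_of_forall_sub_le {ψ G : ℝ → ℝ} {s t : ℝ} (hst : s ≤ t)
    (hψ : ∀ ε > 0, ∃ δ > 0, ∀ a b, s ≤ a → a ≤ b → b ≤ t → b - a ≤ δ →
      ψ b - ψ a ≤ ε * (G b - G a)) : ψ t ≤ ψ s := by
  have key : ∀ ε > 0, ψ t - ψ s ≤ ε * (G t - G s) := by
    intro ε hε
    obtain ⟨δ, hδ, h⟩ := hψ ε hε
    obtain ⟨N, hN⟩ := exists_nat_gt ((t - s) / δ)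
    have hN0 : (0 : ℝ) < N := (div_nonneg (sub_nonneg.2 hst) hδ.le).trans_lt hN
    set τ := (t - s) / N with hτ
    have hτ0 : 0 ≤ τ := div_nonneg (sub_nonneg.2 hst) hN0.le
    have hτδ : τ ≤ δ := by
      rw [hτ, div_le_iff₀ hN0]
      rw [div_lt_iff₀ hδ] at hN
      linarith
    have hNτ : N * τ = t - s := mul_div_cancel₀ _ hN0.ne'
    have ind : ∀ j : ℕ, j ≤ N → ψ (s + j * τ) - ψ s ≤ ε * (G (s + j * τ) - G s) := by
      intro j
      induction j with
      | zero => simp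
      | succ j ih =>
        intro hj
        have h1 := ih (by omega)
        have hj' : ((j + 1 : ℕ) : ℝ) ≤ N := by exact_mod_cast hj
        have h0 : 0 ≤ (j : ℝ) * τ := by positivity
        have h2 := h (s + j * τ) (s + (j + 1 : ℕ) * τ) (by linarith) (by push_cast; linarith)
          (by have := mul_le_mul_of_nonneg_right hj' hτ0; linarith) (by push_cast; linarith)
        linarith
    have := ind N le_rfl
    rwa [hNτ, add_sub_cancel] at this
  have hl : Tendsto (fun ε : ℝ => ε * (G t - G s)) (𝓝[>] 0) (𝓝 0) := by
    refine Tendsto.mono_left ?_ nhdsWithin_le_nhds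
    exact Continuous.tendsto' (by fun_prop) _ _ (by simp)
  have := ge_of_tendsto hl (by filter_upwards [self_mem_nhdsWithin] with ε hε using key ε hε)
  linarith

theorem SpeedLE.flow_energy_inequality (hK : IsDualSet K) {x : H} {L : ℝ} (hx : SpeedLE K x L)
    {s t : ℝ} (hs : 0 ≤ s) (hst : s ≤ t) {k : H} (hk : k ∈ K) :
    ‖flow K x t‖ ^ 2 / 2 + ∫ r in s..t, inner ℝ (flow K x r) k ≤ ‖flow K x s‖ ^ 2 / 2 := by
  have hL := hx.nonneg
  have hc : Continuous fun r => inner ℝ (flow K x r) k := by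
    have := hx.continuous_flow hK
    fun_prop
  have hi : ∀ a b : ℝ, IntervalIntegrable (fun r => inner ℝ (flow K x r) k) volume a b :=
    fun a b => hc.intervalIntegrable a b
  have := le_of_forall_sub_le
    (ψ := fun t => ‖flow K x t‖ ^ 2 / 2 + ∫ r in s..t, inner ℝ (flow K x r) k) (G := id) hst ?_
  · simpa using this
  intro ε hε
  -- Two errors of size `‖k‖ * L * (b - a) ^ 2` occur, one from `le_flow_energy` and one from
  -- freezing the integrand at `b`; the `1` keeps the denominator positive.
  refine ⟨ε / (2 * ‖k‖ * L + 1), by positivity, fun a b ha hab hb hδ => ?_⟩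
  have h1 := hx.le_flow_energy hK (hs.trans ha) hab hk
  have h2 : ∫ r in a..b, inner ℝ (flow K x r) k ≤
      (b - a) * (inner ℝ (flow K x b) k + (b - a) * L * ‖k‖) := by
    calc ∫ r in a..b, inner ℝ (flow K x r) k
        ≤ ∫ r in a..b, (inner ℝ (flow K x b) k + (b - a) * L * ‖k‖) := by
          refine intervalIntegral.integral_mono_on hab (hi a b) (by simp) fun r hr => ?_
          have a1 := real_inner_le_norm (flow K x r - flow K x b) k
          have a2 := hx.norm_flow_sub_le hK (hs.trans (ha.trans hr.1)) hr.2
          have a3 := mul_le_mul_of_nonneg_right (a2.trans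
            (mul_le_mul_of_nonneg_right (sub_le_sub_left hr.1 b) hL)) (norm_nonneg k)
          rw [inner_sub_left] at a1
          linarith
      _ = _ := by rw [intervalIntegral.integral_const, smul_eq_mul]
  have h3 : (∫ r in s..b, inner ℝ (flow K x r) k) - ∫ r in s..a, inner ℝ (flow K x r) k =
      ∫ r in a..b, inner ℝ (flow K x r) k :=
    intervalIntegral.integral_interval_sub_left (hi _ _) (hi _ _)
  have h4 : (b - a) * (2 * ‖k‖ * L + 1) ≤ ε := (le_div_iff₀ (by positivity)).1 hδ
  have h5 := mul_le_mul_of_nonneg_right h4 (sub_nonneg.2 hab)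
  simp only [id]
  nlinarith [sq_nonneg (b - a)]

/-- The inequality no longer involves `L`, so it passes to the closure: the flows converge uniformly
in time, by contraction. -/
theorem flow_energy_inequality (hK : IsDualSet K) {x : H} (hx : x ∈ flowDomain K)
    {s t : ℝ} (hs : 0 ≤ s) (hst : s ≤ t) {k : H} (hk : k ∈ K) :
    ‖flow K x t‖ ^ 2 / 2 + ∫ r in s..t, inner ℝ (flow K x r) k ≤ ‖flow K x s‖ ^ 2 / 2 := by
  obtain ⟨y, hy, hyx⟩ := mem_closure_iff_seq_limit.1 hx
  have hy' : ∀ n, y n ∈ flowDomain K := fun n => subset_closure (hy n)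
  have hn : Tendsto (fun n => ‖y n - x‖) atTop (𝓝 0) := tendsto_iff_norm_sub_tendsto_zero.1 hyx
  have hf : ∀ r, Tendsto (fun n => flow K (y n) r) atTop (𝓝 (flow K x r)) := fun r =>
    tendsto_iff_norm_sub_tendsto_zero.2 (squeeze_zero (fun _ => norm_nonneg _)
      (fun n => norm_flow_sub_le hK (hy' n) hx r) hn)
  have hi : ∀ z ∈ flowDomain K,
      IntervalIntegrable (fun r => inner ℝ (flow K z r) k) volume s t := by
    intro z hz
    have := continuous_flow hK hz
    exact Continuous.intervalIntegrable (by fun_prop) s t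
  have hI : Tendsto (fun n => ∫ r in s..t, inner ℝ (flow K (y n) r) k) atTop
      (𝓝 (∫ r in s..t, inner ℝ (flow K x r) k)) := by
    refine tendsto_iff_norm_sub_tendsto_zero.2 (squeeze_zero (fun _ => norm_nonneg _)
      (g := fun n => ‖y n - x‖ * ‖k‖ * |t - s|) (fun n => ?_) ?_)
    · rw [← intervalIntegral.integral_sub (hi _ (hy' n)) (hi _ hx)]
      refine intervalIntegral.norm_integral_le_of_norm_le_const fun r _ => ?_
      rw [← inner_sub_left]
      exact (norm_inner_le_norm _ _).trans
        (mul_le_mul_of_nonneg_right (norm_flow_sub_le hK (hy' n) hx r) (norm_nonneg _))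
    · simpa using (hn.mul_const ‖k‖).mul_const |t - s|
  refine le_of_tendsto_of_tendsto' ((((hf t).norm.pow 2).div_const 2).add hI)
    (((hf s).norm.pow 2).div_const 2) fun n => ?_
  obtain ⟨L, hL⟩ := hy n
  exact hL.flow_energy_inequality hK hs hst hk

end ConvexFlow
end

noncomputable section

namespace ConvexFlow

open Filter

variable {H : Type*} [NormedAddCommGroup H] [InnerProductSpace ℝ H] [CompleteSpace H]

/-! ### Differentiability almost everywhere of Hilbert space valued curves -/

/-- A bounded family in a Hilbert space converges weakly along every ultrafilter. -/
theorem exists_weak_limit {ι : Type*} (𝒰 : Ultrafilter ι) {g : ι → H} {R : ℝ}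
    (hg : ∀ i, ‖g i‖ ≤ R) :
    ∃ y : H, ∀ φ, Tendsto (fun i => inner ℝ (g i) φ) 𝒰 (𝓝 (inner ℝ y φ)) := by
  let T : ι → WeakDual ℝ H := fun i => StrongDual.toWeakDual (InnerProductSpace.toDual ℝ H (g i))
  -- Banach–Alaoglu in the dual; the Riesz isomorphism carries the limit back to `H`.
  obtain ⟨ℓ, -, hℓ⟩ := (WeakDual.isCompact_closedBall (𝕜 := ℝ) (0 : StrongDual ℝ H) R)
    |>.ultrafilter_le_nhds (𝒰.map T) (by
      refine le_principal_iff.2 (Filter.mem_map.2 (Filter.univ_mem' fun i => ?_))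
      simpa [T] using hg i)
  refine ⟨(InnerProductSpace.toDual ℝ H).symm (WeakDual.toStrongDual ℓ), fun φ => ?_⟩
  have h1 : Tendsto (fun i => T i φ) 𝒰 (𝓝 (ℓ φ)) :=
    ((WeakDual.eval_continuous φ).tendsto ℓ).comp hℓ
  rw [InnerProductSpace.toDual_symm_apply]
  simpa [T] using h1

/-- The integral equals the difference, between `t` and `s`, of the difference quotients of a
primitive of `u`. -/
theorem tendsto_integral_difference_quotient {u : ℝ → H} (hu : Continuous u) (s t : ℝ) :
    Tendsto (fun h : ℝ => ∫ r in s..t, h⁻¹ • (u (r + h) - u r)) (𝓝[≠] 0) (𝓝 (u t - u s)) := by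
  have hd : ∀ τ, HasDerivAt (fun τ => ∫ r in (0 : ℝ)..τ, u r) (u τ) τ := fun τ =>
    (hu.integral_hasStrictDerivAt 0 τ).hasDerivAt
  refine (((hd t).tendsto_slope_zero).sub (hd s).tendsto_slope_zero).congr fun h => ?_
  have hi : ∀ a b, IntervalIntegrable u volume a b := fun a b => hu.intervalIntegrable a b
  have hi' : IntervalIntegrable (fun r => u (r + h)) volume s t :=
    Continuous.intervalIntegrable (by fun_prop) _ _
  rw [intervalIntegral.integral_smul, intervalIntegral.integral_sub hi' (hi _ _),
    intervalIntegral.integral_comp_add_right, ← smul_sub,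
    ← intervalIntegral.integral_interval_sub_left (hi 0 (t + h)) (hi 0 (s + h)),
    ← intervalIntegral.integral_interval_sub_left (hi 0 t) (hi 0 s)]
  congr 1
  abel

/-- The difference quotients are dominated by `β`, hence bounded in `L²`, and `g` is a weak limit of
them. Testing against indicators of intervals times constant vectors identifies its integrals with
increments of `u`. -/
theorem exists_memLp_integral_eq {u : ℝ → H} (hu : Continuous u) {δ : ℝ} {β : ℝ → ℝ}
    (hβ : MemLp β 2 (volume.restrict (Ioi δ)))
    (hq : ∀ t, δ < t → ∀ h, 0 < h → ‖u (t + h) - u t‖ ≤ h * β t) :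
    ∃ g : ℝ → H, MemLp g 2 (volume.restrict (Ioi δ)) ∧
      ∀ s t, δ ≤ s → s ≤ t → u t - u s = ∫ r in s..t, g r := by
  set μ := volume.restrict (Ioi δ)
  let η : ℕ → ℝ := fun n => 1 / ((n : ℝ) + 1)
  have hη : ∀ n, 0 < η n := fun n => Nat.one_div_pos_of_nat
  let Q : ℕ → ℝ → H := fun n t => (η n)⁻¹ • (u (t + η n) - u t)
  have hQc : ∀ n, Continuous (Q n) := fun n => by fun_prop
  have hQb : ∀ n, ∀ᵐ t ∂μ, ‖Q n t‖ ≤ ‖β t‖ := by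
    intro n
    filter_upwards [ae_restrict_mem measurableSet_Ioi] with t ht
    simp only [Q]
    rw [norm_smul, norm_inv, Real.norm_of_nonneg (hη n).le, inv_mul_le_iff₀ (hη n)]
    exact (hq t ht _ (hη n)).trans (mul_le_mul_of_nonneg_left (le_abs_self _) (hη n).le)
  have hQm : ∀ n, MemLp (Q n) 2 μ := fun n =>
    hβ.mono (hQc n).aestronglyMeasurable (hQb n)
  let 𝒰 : Ultrafilter ℕ := Ultrafilter.of atTop
  obtain ⟨y, hy⟩ := exists_weak_limit 𝒰 (g := fun n => (hQm n).toLp) (R := ‖hβ.toLp‖) (by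
    intro n
    refine Lp.norm_le_norm_of_ae_le ?_
    filter_upwards [hQb n, (hQm n).coeFn_toLp, hβ.coeFn_toLp] with t h1 h2 h3
    rwa [h2, h3])
  refine ⟨y, Lp.memLp y, fun s t hs hst => ?_⟩
  have hsub : Ioc s t ⊆ Ioi δ := fun r hr => hs.trans_lt hr.1
  have hres : μ.restrict (Ioc s t) = volume.restrict (Ioc s t) :=
    Measure.restrict_restrict_of_subset hsub
  have hfin : μ (Ioc s t) ≠ ∞ := by
    refine ((Measure.restrict_apply_le (Ioi δ) (Ioc s t)).trans_lt ?_).ne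
    simp
  refine ext_inner_left ℝ fun c => ?_
  have h1 := hy (indicatorConstLp 2 measurableSet_Ioc hfin c)
  have h2 : ∀ f : Lp H 2 μ, inner ℝ f (indicatorConstLp 2 measurableSet_Ioc hfin c) =
      inner ℝ c (∫ r in s..t, f r) := by
    intro f
    rw [real_inner_comm, L2.inner_indicatorConstLp_eq_inner_setIntegral, hres,
      intervalIntegral.integral_of_le hst]
  simp only [h2] at h1
  have h3 : ∀ n, ∫ r in s..t, ((hQm n).toLp : ℝ → H) r = ∫ r in s..t, Q n r := by
    intro n
    rw [intervalIntegral.integral_of_le hst, intervalIntegral.integral_of_le hst, ← hres]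
    exact integral_congr_ae (ae_restrict_of_ae (hQm n).coeFn_toLp)
  simp only [h3] at h1
  have hη0 : Tendsto η atTop (𝓝[≠] 0) := tendsto_nhdsWithin_iff.2
    ⟨tendsto_one_div_add_atTop_nhds_zero_nat, Eventually.of_forall fun n => (hη n).ne'⟩
  have h4 : Tendsto (fun n => ∫ r in s..t, Q n r) 𝒰 (𝓝 (u t - u s)) :=
    ((tendsto_integral_difference_quotient hu s t).comp hη0).mono_left (Ultrafilter.of_le _)
  exact tendsto_nhds_unique (tendsto_const_nhds.inner h4) h1

/-- Lebesgue's differentiation theorem, for `g` extended by zero to the line. -/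
theorem ae_hasDerivAt_of_integral_eq {u g : ℝ → H} {δ : ℝ}
    (hg : MemLp g 2 (volume.restrict (Ioi δ)))
    (hu : ∀ s t, δ ≤ s → s ≤ t → u t - u s = ∫ r in s..t, g r) :
    ∀ᵐ t ∂volume.restrict (Ioi δ), HasDerivAt u (g t) t := by
  have hl : LocallyIntegrable ((Ioi δ).indicator g) volume :=
    ((memLp_indicator_iff_restrict measurableSet_Ioi).2 hg).locallyIntegrable one_le_two
  rw [ae_restrict_iff' measurableSet_Ioi]
  filter_upwards [_root_.LocallyIntegrable.ae_hasDerivAt_integral hl] with t ht htδ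
  have h1 := (ht δ).const_add (u δ)
  rw [indicator_of_mem htδ] at h1
  refine h1.congr_of_eventuallyEq ?_
  filter_upwards [lt_mem_nhds htδ] with τ hτ
  rw [← sub_eq_iff_eq_add', hu δ τ le_rfl hτ.le]
  refine intervalIntegral.integral_congr_ae (Eventually.of_forall fun r hr => ?_)
  rw [uIoc_of_le (le_of_lt hτ)] at hr
  exact (indicator_of_mem (s := Ioi δ) hr.1 g).symm

variable {K : Set H}

theorem memLp_const_div {δ : ℝ} (hδ : 0 < δ) (C : ℝ) :
    MemLp (fun t : ℝ => C / t) 2 (volume.restrict (Ioi δ)) := by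
  have hm : AEStronglyMeasurable (fun t : ℝ => C / t) (volume.restrict (Ioi δ)) :=
    (measurable_const.div measurable_id).aestronglyMeasurable
  rw [memLp_two_iff_integrable_sq hm]
  have h1 : IntegrableOn (fun t : ℝ => t ^ (-2 : ℝ)) (Ioi δ) :=
    integrableOn_Ioi_rpow_of_lt (by norm_num) hδ
  refine IntegrableOn.congr_fun (h1.const_mul (C ^ 2)) (fun t ht => ?_) measurableSet_Ioi
  have ht0 : 0 < t := hδ.trans ht
  rw [Real.rpow_neg ht0.le, div_pow, div_eq_mul_inv, Real.rpow_ofNat]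

/-- The regularizing effect bounds difference quotients by `2 * ‖x‖ / t`, which is square integrable
away from `0`. -/
theorem flow_memLp_deriv (hK : IsDualSet K) {x : H} (hx : x ∈ flowDomain K) {δ : ℝ} (hδ : 0 < δ) :
    MemLp (deriv (flow K x)) 2 (volume.restrict (Ioi δ)) ∧
    (∀ s t, δ ≤ s → s ≤ t → flow K x t - flow K x s = ∫ r in s..t, deriv (flow K x) r) ∧
    ∀ᵐ t ∂volume.restrict (Ioi δ), DifferentiableAt ℝ (flow K x) t := by
  obtain ⟨g, hg, hint⟩ := exists_memLp_integral_eq (continuous_flow hK hx)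
    (memLp_const_div hδ (2 * ‖x‖)) (fun t ht h hh => by
      have := norm_flow_sub_flow_le hK hx (hδ.trans ht) (le_add_of_nonneg_right (a := t) hh.le)
      rwa [add_sub_cancel_left, mul_comm] at this)
  have hd := ae_hasDerivAt_of_integral_eq hg hint
  have he : g =ᵐ[volume.restrict (Ioi δ)] deriv (flow K x) := by
    filter_upwards [hd] with t ht using ht.deriv.symm
  refine ⟨hg.ae_eq he, fun s t hs hst => ?_, ?_⟩
  · rw [hint s t hs hst]
    refine intervalIntegral.integral_congr_ae ?_
    rw [uIoc_of_le hst]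
    filter_upwards [(ae_restrict_iff' measurableSet_Ioi).1 he] with r hr hrs
    exact hr (hs.trans_lt hrs.1)
  · filter_upwards [hd] with t ht using ht.differentiableAt

/-- Membership in `K` is the limit of `inv_smul_flow_sub_mem`. The normal inequality is the right
derivative at `t` of the energy inequality started at `t`. -/
theorem isNormal_flow (hK : IsDualSet K) {x : H} (hx : x ∈ flowDomain K) {t : ℝ} (ht : 0 < t)
    (hd : DifferentiableAt ℝ (flow K x) t) : IsNormal K (flow K x t) (-deriv (flow K x) t) := by
  have hder := hd.hasDerivAt
  constructor
  · refine hK.isClosed.mem_of_tendsto hder.tendsto_slope_zero_right.neg ?_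
    filter_upwards [self_mem_nhdsWithin] with h (hh : 0 < h)
    have := inv_smul_flow_sub_mem hK hx ht.le (lt_add_of_pos_right t hh)
    rwa [add_sub_cancel_left, ← neg_sub, smul_neg] at this
  · intro k hk
    have hc : Continuous fun r => inner ℝ (flow K x r) k := by
      have := continuous_flow hK hx
      fun_prop
    have h1 : HasDerivAt (fun τ => ‖flow K x τ‖ ^ 2 / 2 + ∫ r in t..τ, inner ℝ (flow K x r) k)
        (2 * inner ℝ (flow K x t) (deriv (flow K x) t) / 2 + inner ℝ (flow K x t) k) t :=
      (hder.norm_sq.div_const 2).add (hc.integral_hasStrictDerivAt t t).hasDerivAt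
    have h2 := le_of_tendsto h1.tendsto_slope_zero_right (b := 0) (by
      filter_upwards [self_mem_nhdsWithin] with h (hh : 0 < h)
      have := flow_energy_inequality hK hx ht.le (le_add_of_nonneg_right (a := t) hh.le) hk
      refine smul_nonpos_of_nonneg_of_nonpos (inv_nonneg.2 hh.le) ?_
      rw [intervalIntegral.integral_same]
      linarith)
    rw [sub_neg_eq_add, inner_add_right]
    linarith

/-! ### Gradient flows of support functionals -/

open TVFlow

/-- The subdifferential at the origin of a positively homogeneous functional. -/
def dualSet (E : H → EReal) : Set H := {f | ∀ v, ((inner ℝ v f : ℝ) : EReal) ≤ E v}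

omit [CompleteSpace H] in
theorem isDualSet_dualSet {E : H → EReal} (hE : ∀ v, 0 ≤ E v) : IsDualSet (dualSet E) := by
  refine ⟨?_, ?_, fun v => by simpa using hE v⟩
  · rw [dualSet, ofPred_forall]
    refine convex_iInter fun v => ?_
    induction E v using EReal.rec with
    | bot => simpa using convex_empty
    | coe c =>
      simp only [EReal.coe_le_coe_iff]
      exact convex_halfSpace_le (innerₗ H v).isLinear c
    | top => simpa using convex_univ
  · rw [dualSet, ofPred_forall]
    refine isClosed_iInter fun v => isClosed_le ?_ continuous_const
    exact continuous_coe_real_ereal.comp (by fun_prop)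

-- Since `C ⊆ dualSet E`, normality gives `E y ≤ ⟪y, f⟫`; then `⟪y + h, f⟫ ≤ E (y + h)` is the
-- subgradient inequality.
omit [CompleteSpace H] in
theorem IsNormal.mem_subdifferential {E : H → EReal} {C : Set H}
    (hE : ∀ v, E v = ⨆ f ∈ C, ((inner ℝ v f : ℝ) : EReal)) {y f : H}
    (hn : IsNormal (dualSet E) y f) : f ∈ subdifferential E y := by
  have h1 : E y ≤ ((inner ℝ y f : ℝ) : EReal) := by
    rw [hE y]
    refine iSup₂_le fun k hk => EReal.coe_le_coe_iff.2 ?_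
    have hk' : k ∈ dualSet E := by
      intro v
      rw [hE v]
      exact le_iSup₂ (f := fun f (_ : f ∈ C) => ((inner ℝ v f : ℝ) : EReal)) k hk
    have := hn.2 k hk'
    rw [inner_sub_right] at this
    linarith
  refine ⟨h1.trans_lt (EReal.coe_lt_top _), fun h => ?_⟩
  calc E y + ((inner ℝ h f : ℝ) : EReal)
      ≤ ((inner ℝ y f : ℝ) : EReal) + ((inner ℝ h f : ℝ) : EReal) := add_le_add_left h1 _
    _ = ((inner ℝ (y + h) f : ℝ) : EReal) := by rw [inner_add_left, EReal.coe_add]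
    _ ≤ E (y + h) := hn.1 _

/-- Resolvents have bounded speed and approximate `x`: with `y`, `f` the Euler pair, `⟪y, f⟫ ≥ 0`
and `⟪x, f⟫ ≤ E x` give `‖x - y‖ ^ 2 ≤ h * E x`. -/
theorem closure_effectiveDomain_subset_flowDomain {E : H → EReal} (hE : ∀ v, 0 ≤ E v) :
    closure (effectiveDomain E) ⊆ flowDomain (dualSet E) := by
  refine closure_minimal (fun x hx => ?_) isClosed_closure
  have hK := isDualSet_dualSet hE
  obtain ⟨c, hc⟩ : ∃ c : ℝ, E x = c := by
    lift E x to ℝ using ⟨(show E x < ⊤ from hx).ne, (EReal.bot_lt_zero.trans_le (hE x)).ne'⟩ with c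
    exact ⟨c, rfl⟩
  refine Metric.mem_closure_iff.2 fun ε hε => ?_
  have hlim : Tendsto (fun h : ℝ => h * c) (𝓝[>] 0) (𝓝 0) := by
    refine Tendsto.mono_left ?_ nhdsWithin_le_nhds
    exact Continuous.tendsto' (by fun_prop) _ _ (by simp)
  obtain ⟨h, h1, hh⟩ := ((hlim.eventually (gt_mem_nhds (show 0 < ε ^ 2 by positivity))).and
    self_mem_nhdsWithin).exists
  have hh : 0 < h := hh
  refine ⟨resolvent (dualSet E) h x, ⟨_, speedLE_resolvent hK hh x⟩, ?_⟩
  obtain ⟨hf, hn⟩ := isNormal_resolvent hK hh x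
  have h2 := hn 0 hK.zero_mem
  have h3 := hf x
  rw [hc, EReal.coe_le_coe_iff] at h3
  have e := resolvent_add_smul_yosida (K := dualSet E) h x
  set y := resolvent (dualSet E) h x
  set f := yosida (dualSet E) h x
  have e2 : x - y = h • f := by rw [← e, add_sub_cancel_left]
  rw [← e, inner_add_left, real_inner_smul_left, real_inner_self_eq_norm_sq] at h3
  rw [zero_sub, inner_neg_right] at h2
  rw [dist_eq_norm, e2, norm_smul, Real.norm_of_nonneg hh.le]
  refine lt_of_pow_lt_pow_left₀ 2 hε.le ?_
  rw [mul_pow]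
  nlinarith

theorem exists_isGradientFlow {E : H → EReal} {C : Set H} (h0 : (0 : H) ∈ C)
    (hE : ∀ v, E v = ⨆ f ∈ C, ((inner ℝ v f : ℝ) : EReal)) {x : H}
    (hx : x ∈ closure (effectiveDomain E)) : ∃ u : C(ℝ≥0, H), IsGradientFlow E x u := by
  have hE0 : ∀ v, 0 ≤ E v := by
    intro v
    rw [hE v]
    simpa using le_iSup₂ (f := fun f (_ : f ∈ C) => ((inner ℝ v f : ℝ) : EReal)) 0 h0
  have hK := isDualSet_dualSet hE0
  have hx' := closure_effectiveDomain_subset_flowDomain hE0 hx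
  set K := dualSet E
  refine ⟨⟨fun t => flow K x t, (continuous_flow hK hx').comp NNReal.continuous_coe⟩,
    deriv (flow K x), fun δ hδ => (flow_memLp_deriv hK hx' hδ).1, fun s t hs hst => ?_, ?_, ?_⟩
  · exact (flow_memLp_deriv hK hx' (NNReal.coe_pos.2 hs)).2.1 s t le_rfl (NNReal.coe_le_coe.2 hst)
  · rw [ae_restrict_iff' measurableSet_Ioi]
    -- Differentiability is known almost everywhere beyond each `δ > 0`; countably many `δ` cover
    -- all positive times.
    have h1 : ∀ n : ℕ, ∀ᵐ t : ℝ, 1 / ((n : ℝ) + 1) < t → DifferentiableAt ℝ (flow K x) t := fun n =>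
      (ae_restrict_iff' measurableSet_Ioi).1
        (flow_memLp_deriv hK hx' (Nat.one_div_pos_of_nat (n := n))).2.2
    filter_upwards [ae_all_iff.2 h1] with t ht (ht0 : 0 < t)
    obtain ⟨n, hn⟩ := exists_nat_one_div_lt ht0
    have := (isNormal_flow hK hx' ht0 (ht n hn)).mem_subdifferential hE
    simpa [Real.coe_toNNReal _ ht0.le] using this
  · exact flow_of_nonpos hK hx' (by simp)

/-! ### Monotonicity, contraction and uniqueness -/

omit [CompleteSpace H] in
theorem subdifferential_monotone {E : H → EReal} (hE : ∀ v, 0 ≤ E v) {v v' f f' : H}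
    (hf : f ∈ subdifferential E v) (hf' : f' ∈ subdifferential E v') :
    0 ≤ inner ℝ (v - v') (f - f') := by
  have fin : ∀ w ∈ effectiveDomain E, ∃ c : ℝ, E w = c := by
    intro w hw
    lift E w to ℝ using ⟨(show E w < ⊤ from hw).ne, (EReal.bot_lt_zero.trans_le (hE w)).ne'⟩ with c
    exact ⟨c, rfl⟩
  obtain ⟨c, hc⟩ := fin v hf.1
  obtain ⟨c', hc'⟩ := fin v' hf'.1
  have h1 := hf.2 (v' - v)
  have h2 := hf'.2 (v - v')
  rw [add_sub_cancel, hc, hc', ← EReal.coe_add, EReal.coe_le_coe_iff] at h1 h2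
  simp only [inner_sub_left, inner_sub_right] at *
  linarith

/-- Formally `‖w‖ ^ 2` has derivative `2 * ⟪w, q⟫ ≤ 0` for `w = u - v`. On a short interval its
increment is at most `2 * ∫ ⟪w b, q r⟫`, and uniform continuity lets `w r` replace `w b` with error
`ε * ‖q r‖`, so no chain rule is needed. -/
theorem norm_sub_le_of_isGradientFlow {E : H → EReal} (hE : ∀ v, 0 ≤ E v) {x x' : H}
    {u v : C(ℝ≥0, H)} (hu : IsGradientFlow E x u) (hv : IsGradientFlow E x' v) {s t : ℝ≥0}
    (hs : 0 < s) (hst : s ≤ t) : ‖u t - v t‖ ≤ ‖u s - v s‖ := by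
  obtain ⟨g, hg, hgi, hga, -⟩ := hu
  obtain ⟨g', hg', hgi', hga', -⟩ := hv
  have hs' : (0 : ℝ) < s := hs
  have hst' : (s : ℝ) ≤ t := hst
  let w : ℝ → H := fun τ => u τ.toNNReal - v τ.toNNReal
  let q : ℝ → H := fun τ => g τ - g' τ
  have hwc : Continuous w := by
    have := u.continuous.comp continuous_real_toNNReal
    have := v.continuous.comp continuous_real_toNNReal
    exact Continuous.sub ‹_› ‹_›
  have hint : ∀ {f : ℝ → H}, (∀ δ : ℝ, 0 < δ → MemLp f 2 (volume.restrict (Ioi δ))) →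
      ∀ a b : ℝ, (s : ℝ) ≤ a → a ≤ b → IntervalIntegrable f volume a b := by
    intro f hf a b ha hab
    have h1 := (memLp_indicator_iff_restrict measurableSet_Ioi).2 (hf (s / 2) (by linarith))
    have h2 := h1.locallyIntegrable one_le_two
    have h3 := (h2.integrableOn_isCompact (isCompact_Icc (a := a) (b := b)))
    rw [intervalIntegrable_iff_integrableOn_Icc_of_le hab]
    refine h3.congr_fun (fun r hr => indicator_of_mem ?_ _) measurableSet_Icc
    exact lt_of_lt_of_le (by linarith) (ha.trans hr.1)
  have hqi : ∀ a b : ℝ, (s : ℝ) ≤ a → a ≤ b → IntervalIntegrable q volume a b :=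
    fun a b ha hab => (hint hg a b ha hab).sub (hint hg' a b ha hab)
  have hw : ∀ a b : ℝ, (s : ℝ) ≤ a → a ≤ b → w b - w a = ∫ r in a..b, q r := by
    intro a b ha hab
    have ha0 : 0 < a := hs'.trans_le ha
    have p1 : 0 < a.toNNReal := Real.toNNReal_pos.2 ha0
    have p2 : a.toNNReal ≤ b.toNNReal := Real.toNNReal_le_toNNReal hab
    have e1 := hgi _ _ p1 p2
    have e2 := hgi' _ _ p1 p2
    rw [Real.coe_toNNReal _ ha0.le, Real.coe_toNNReal _ (ha0.le.trans hab)] at e1 e2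
    rw [intervalIntegral.integral_sub (hint hg a b ha hab) (hint hg' a b ha hab), ← e1, ← e2]
    simp only [w]
    abel
  have hmono : ∀ᵐ r : ℝ, 0 < r → inner ℝ (w r) (q r) ≤ 0 := by
    filter_upwards [(ae_restrict_iff' measurableSet_Ioi).1 hga,
      (ae_restrict_iff' measurableSet_Ioi).1 hga'] with r h1 h2 hr
    have := subdifferential_monotone hE (h1 hr) (h2 hr)
    have e : -g r - -g' r = -(q r) := by simp only [q]; abel
    rw [e, inner_neg_right] at this
    linarith
  have main := le_of_forall_sub_le (ψ := fun τ => ‖w τ‖ ^ 2)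
    (G := fun τ => 2 * ∫ r in (s : ℝ)..τ, ‖q r‖) hst' ?_
  · simp only [w, Real.toNNReal_coe] at main
    exact le_of_sq_le_sq main (norm_nonneg _)
  intro ε hε
  obtain ⟨δ, hδ, huc⟩ := Metric.uniformContinuousOn_iff_le.1
    ((isCompact_Icc (a := (s : ℝ)) (b := t)).uniformContinuousOn_of_continuous hwc.continuousOn) ε hε
  refine ⟨δ, hδ, fun a b ha hab hb hle => ?_⟩
  have hqab := hqi a b ha hab
  have h1 : ‖w b‖ ^ 2 - ‖w a‖ ^ 2 ≤ 2 * inner ℝ (w b) (w b - w a) := by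
    have := norm_sub_sq_real (w b) (w a)
    rw [inner_sub_right, real_inner_self_eq_norm_sq]
    nlinarith [sq_nonneg ‖w b - w a‖]
  have h2 : inner ℝ (w b) (w b - w a) = ∫ r in a..b, inner ℝ (w b) (q r) := by
    rw [hw a b ha hab]
    exact ((innerSL ℝ (w b)).intervalIntegral_comp_comm hqab).symm
  have h3 : ∫ r in a..b, inner ℝ (w b) (q r) ≤ ∫ r in a..b, ε * ‖q r‖ := by
    refine intervalIntegral.integral_mono_ae_restrict hab
      ⟨(innerSL ℝ (w b)).integrable_comp hqab.1, (innerSL ℝ (w b)).integrable_comp hqab.2⟩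
      (hqab.norm.const_mul ε) ?_
    refine (ae_restrict_iff' measurableSet_Icc).2 ?_
    filter_upwards [hmono] with r hr hrab
    have hr0 := hr (hs'.trans_le (ha.trans hrab.1))
    have b1 := huc b ⟨ha.trans hab, hb⟩ r ⟨ha.trans hrab.1, hrab.2.trans hb⟩ (by
      rw [Real.dist_eq, abs_of_nonneg (sub_nonneg.2 hrab.2)]; linarith [hrab.1])
    rw [dist_eq_norm] at b1
    have b2 := real_inner_le_norm (w b - w r) (q r)
    have b3 := mul_le_mul_of_nonneg_right b1 (norm_nonneg (q r))
    rw [inner_sub_left] at b2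
    linarith
  rw [intervalIntegral.integral_const_mul] at h3
  have h4 := intervalIntegral.integral_interval_sub_left
    (hqi s b le_rfl (ha.trans hab)).norm (hqi s a le_rfl ha).norm
  rw [← mul_sub, h4]
  linarith

/-- The contraction holds only from positive times; continuity at `0` closes the gap. -/
theorem isGradientFlow_unique {E : H → EReal} (hE : ∀ v, 0 ≤ E v) {x : H} {u v : C(ℝ≥0, H)}
    (hu : IsGradientFlow E x u) (hv : IsGradientFlow E x v) : u = v := by
  ext t
  rcases eq_or_ne t 0 with rfl | ht
  · obtain ⟨-, -, -, -, h1⟩ := hu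
    obtain ⟨-, -, -, -, h2⟩ := hv
    rw [h1, h2]
  have hu0 : u 0 = x := by obtain ⟨-, -, -, -, h⟩ := hu; exact h
  have hv0 : v 0 = x := by obtain ⟨-, -, -, -, h⟩ := hv; exact h
  have ht0 : 0 < t := pos_iff_ne_zero.2 ht
  have hc : Tendsto (fun s : ℝ≥0 => ‖u s - v s‖) (𝓝[>] 0) (𝓝 0) := by
    refine Tendsto.mono_left ?_ nhdsWithin_le_nhds
    exact Continuous.tendsto' (by fun_prop) _ _ (by rw [hu0, hv0]; simp)
  have := ge_of_tendsto hc (b := ‖u t - v t‖) (by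
    filter_upwards [Ioc_mem_nhdsGT ht0] with s hs
      using norm_sub_le_of_isGradientFlow hE hu hv hs.1 hs.2)
  exact sub_eq_zero.1 (norm_le_zero_iff.1 this)

/-- The gradient flow of a nonnegative support functional exists, is unique, and starts from every
point of the closure of the effective domain. -/
theorem existsUnique_isGradientFlow {E : H → EReal} {C : Set H} (h0 : (0 : H) ∈ C)
    (hE : ∀ v, E v = ⨆ f ∈ C, ((inner ℝ v f : ℝ) : EReal)) {x : H}
    (hx : x ∈ closure (effectiveDomain E)) : ∃! u : C(ℝ≥0, H), IsGradientFlow E x u := by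
  obtain ⟨u, hu⟩ := exists_isGradientFlow h0 hE hx
  refine ⟨u, hu, fun v hv => isGradientFlow_unique (fun w => ?_) hv hu⟩
  rw [hE w]
  simpa using le_iSup₂ (f := fun f (_ : f ∈ C) => ((inner ℝ w f : ℝ) : EReal)) 0 h0

end ConvexFlow
end

noncomputable section

namespace TVFlow

/-! ### Test fields and regular functions -/

/-- Square integrable functions whose distributional gradient is bounded with compact support. -/
def IsRegular {n : ℕ} (Ω : Region n) (G : Ω → ℝ) : Prop :=
  MemLp G 2 (volume : Measure Ω) ∧ ∃ (M : ℝ≥0) (A : Set Ω), IsCompact A ∧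
    ∀ φ d, IsTestField Ω φ d → ‖∫ x, G x * d x‖ₑ ≤ M * ∫⁻ x in A, ‖φ x‖ₑ

theorem isTestField_zero {n : ℕ} : ∀ Ω : Region n, IsTestField Ω 0 0
  | .domain U _ _ => by
    refine ⟨0, contDiff_const, HasCompactSupport.zero, by simp, fun x => ⟨rfl, ?_⟩⟩
    change (0 : ℝ) = _
    simp [divergence]
  | .torus τ _ => by
    refine ⟨contDiff_const, fun y => ?_⟩
    change (0 : ℝ) = divergence (fun _ => 0) y
    simp [divergence]

/-! ### Domains -/

section Domain

attribute [local instance] Measure.Subtype.measureSpace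

variable {n : ℕ}

local notation "E" n => EuclideanSpace ℝ (Fin n)

theorem continuous_divergence {Φ : (E n) → E n} (hΦ : ContDiff ℝ 1 Φ) :
    Continuous (divergence Φ) := by
  have h1 := hΦ.continuous_fderiv one_ne_zero
  unfold divergence
  fun_prop

theorem hasCompactSupport_divergence {Φ : (E n) → E n} (hΦ : HasCompactSupport Φ) :
    HasCompactSupport (divergence Φ) := by
  refine (hΦ.fderiv (𝕜 := ℝ)).mono fun y hy h0 => hy ?_
  simp [divergence, h0]

theorem fderiv_apply_coord {Φ : (E n) → E n} (hΦ : ContDiff ℝ 1 Φ) (y v : E n) (i : Fin n) :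
    fderiv ℝ (fun z => Φ z i) y v = fderiv ℝ Φ y v i := by
  have h := (hΦ.differentiable one_ne_zero y).hasFDerivAt
  have h2 := ((EuclideanSpace.proj (𝕜 := ℝ) i).hasFDerivAt).comp y h
  have h3 : HasFDerivAt (fun z => Φ z i) ((EuclideanSpace.proj (𝕜 := ℝ) i).comp (fderiv ℝ Φ y)) y := h2
  rw [h3.fderiv]
  rfl

theorem sum_fderiv_single_mul (ℓ : (E n) →L[ℝ] ℝ) (v : E n) :
    ∑ i, ℓ (EuclideanSpace.single i 1) * v i = ℓ v := by
  conv_rhs => rw [← (EuclideanSpace.basisFun (Fin n) ℝ).sum_repr v]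
  simp [mul_comm]

/-- Integration by parts in each coordinate; the compact support of `G` alone makes all terms
integrable. -/
theorem integral_mul_divergence {G : (E n) → ℝ} (hG : ContDiff ℝ 1 G) (hGc : HasCompactSupport G)
    {Φ : (E n) → E n} (hΦ : ContDiff ℝ 1 Φ) :
    ∫ y, G y * divergence Φ y = -∫ y, fderiv ℝ G y (Φ y) := by
  have hdG := hG.continuous_fderiv one_ne_zero
  have hΦi : ∀ i, ContDiff ℝ 1 fun z => Φ z i := fun i =>
    (EuclideanSpace.proj (𝕜 := ℝ) i).contDiff.comp hΦ
  have hdΦ := hΦ.continuous_fderiv one_ne_zero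
  have hΦc := hΦ.continuous
  have hGcont := hG.continuous
  have i1 : ∀ i, Integrable fun y => fderiv ℝ G y (EuclideanSpace.single i 1) * Φ y i := by
    intro i
    refine Continuous.integrable_of_hasCompactSupport (by fun_prop) ?_
    refine (hGc.fderiv (𝕜 := ℝ)).mono fun y hy h0 => hy ?_
    simp [h0]
  have i2 : ∀ i, Integrable fun y => G y * fderiv ℝ Φ y (EuclideanSpace.single i 1) i := by
    intro i
    exact Continuous.integrable_of_hasCompactSupport (by fun_prop) hGc.mul_right
  have key : ∀ i, ∫ y, G y * fderiv ℝ Φ y (EuclideanSpace.single i 1) i =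
      -∫ y, fderiv ℝ G y (EuclideanSpace.single i 1) * Φ y i := by
    intro i
    have := integral_mul_fderiv_eq_neg_fderiv_mul_of_integrable (μ := (volume : Measure (E n)))
      (f := G) (g := fun z => Φ z i) (v := EuclideanSpace.single i 1) (i1 i)
      (by simpa only [fderiv_apply_coord hΦ] using i2 i)
      (Continuous.integrable_of_hasCompactSupport (by fun_prop) hGc.mul_right)
      (fun x _ => hG.differentiable one_ne_zero x)
      (fun x _ => (hΦi i).differentiable one_ne_zero x)
    simpa only [fderiv_apply_coord hΦ] using this
  have e : (fun y => fderiv ℝ G y (Φ y)) =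
      fun y => ∑ i, fderiv ℝ G y (EuclideanSpace.single i 1) * Φ y i :=
    funext fun y => (sum_fderiv_single_mul _ _).symm
  simp only [e, divergence, Finset.mul_sum]
  rw [integral_finsetSum _ fun i _ => i2 i, integral_finsetSum _ fun i _ => i1 i,
    ← Finset.sum_neg_distrib]
  exact Finset.sum_congr rfl fun i _ => key i

variable {U : Set (E n)}

theorem integral_domain (hU : IsOpen U) {f : (E n) → ℝ} (hf : ∀ y ∉ U, f y = 0) :
    ∫ x : U, f x = ∫ y, f y := by
  rw [← setIntegral_eq_integral_of_forall_compl_eq_zero hf]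
  exact integral_subtype_comap hU.measurableSet f

theorem memLp_domain (hU : IsOpen U) {f : (E n) → ℝ} (hf : Continuous f) (hfc : HasCompactSupport f) :
    MemLp (fun x : U => f x) 2 (volume : Measure U) :=
  ((hf.memLp_of_hasCompactSupport hfc).restrict U).comp_measurePreserving
    (measurePreserving_subtype_coe hU.measurableSet)

theorem memLp_of_isTestField_domain (hU : IsOpen U) (hc : IsConnected U)
    {φ : U → E n} {d : U → ℝ}
    (h : IsTestField (.domain U hU hc) φ d) : MemLp d 2 (volume : Measure U) := by
  obtain ⟨Φ, h1, h2, -, h3⟩ := h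
  rw [funext fun x => (h3 x).2]
  exact memLp_domain hU (continuous_divergence (h1.of_le (by exact_mod_cast le_top)))
    (hasCompactSupport_divergence h2)

/-- After integration by parts, `M` is a bound for the derivative of `G` and `A` is its support. -/
theorem isRegular_domain (hU : IsOpen U) (hc : IsConnected U)
    {G : (E n) → ℝ} (hG : ContDiff ℝ 1 G) (hGc : HasCompactSupport G)
    (hGU : tsupport G ⊆ U) : IsRegular (.domain U hU hc) (fun x : U => G x) := by
  have hdG := hG.continuous_fderiv one_ne_zero
  obtain ⟨M, hM⟩ := hdG.bounded_above_of_compact_support (hGc.fderiv (𝕜 := ℝ))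
  refine ⟨memLp_domain hU hG.continuous hGc, M.toNNReal, Subtype.val ⁻¹' tsupport G,
    Topology.IsInducing.subtypeVal.isCompact_preimage' hGc (by simpa using hGU), ?_⟩
  rintro φ d ⟨Φ, h1, h2, h2', h3⟩
  have h1' : ContDiff ℝ 1 Φ := h1.of_le (by exact_mod_cast le_top)
  have hz : ∀ y ∉ tsupport G, fderiv ℝ G y = 0 := fun y hy =>
    image_eq_zero_of_notMem_tsupport fun h => hy (tsupport_fderiv_subset ℝ h)
  have e1 : ∫ x : U, G x * d x = -∫ x : U, fderiv ℝ G x (φ x) := by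
    have a1 : ∫ x : U, G x * d x = ∫ x : U, G x * divergence Φ x := by
      simp only [fun x => (h3 x).2]
    have a2 : ∫ x : U, fderiv ℝ G x (φ x) = ∫ x : U, fderiv ℝ G x (Φ x) := by
      simp only [fun x => (h3 x).1]
    rw [a1, a2, integral_domain hU (f := fun y => G y * divergence Φ y),
      integral_domain hU (f := fun y => fderiv ℝ G y (Φ y)), integral_mul_divergence hG hGc h1']
    · intro y hy
      simp [hz y fun h => hy (hGU h)]
    · intro y hy
      simp [image_eq_zero_of_notMem_tsupport fun h => hy (hGU h)]
  change ‖∫ x : U, G x * d x‖ₑ ≤ _ * ∫⁻ x : U in Subtype.val ⁻¹' tsupport G, ‖φ x‖ₑ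
  rw [e1, enorm_neg]
  have hm : MeasurableSet (Subtype.val ⁻¹' tsupport G : Set U) :=
    measurable_subtype_coe (isClosed_tsupport G).measurableSet
  refine (enorm_integral_le_lintegral_enorm _).trans ?_
  rw [← lintegral_const_mul' _ _ ENNReal.coe_ne_top, ← lintegral_indicator hm]
  refine lintegral_mono fun x => ?_
  by_cases hx : x ∈ (Subtype.val ⁻¹' tsupport G : Set U)
  · rw [indicator_of_mem hx]
    refine ((fderiv ℝ G x).le_opENorm _).trans ?_
    gcongr
    rw [← ofReal_norm]
    exact ENNReal.ofReal_le_ofReal (hM x)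
  · rw [indicator_of_notMem hx, hz _ hx]
    simp

/-- The fundamental lemma of the calculus of variations, applied to the extension of `w` by zero. -/
theorem ae_eq_zero_of_isRegular_domain (hU : IsOpen U) (hc : IsConnected U)
    {w : U → ℝ} (hw : MemLp w 2 (volume : Measure U))
    (h : ∀ G : U → ℝ, IsRegular (.domain U hU hc) G → ∫ x : U, G x * w x = 0) :
    w =ᵐ[(volume : Measure U)] 0 := by
  have he : MeasurableEmbedding (Subtype.val : U → E n) :=
    MeasurableEmbedding.subtype_coe hU.measurableSet
  have hmp : MeasurePreserving (Subtype.val : U → E n) volume (volume.restrict U) :=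
    measurePreserving_subtype_coe hU.measurableSet
  let W : (E n) → ℝ := Function.extend Subtype.val w 0
  have hW : ∀ x : U, W x = w x := fun x => Subtype.val_injective.extend_apply _ _ _
  have hWc : W ∘ Subtype.val = w := funext hW
  have hWm : MemLp W 2 (volume.restrict U) := by
    rw [← hmp.map_eq, he.memLp_map_measure_iff, hWc]
    exact hw
  have hl : LocallyIntegrableOn W U volume :=
    locallyIntegrableOn_of_locallyIntegrable_restrict (hWm.locallyIntegrable one_le_two)
  have h0 := hU.ae_eq_zero_of_integral_contDiff_smul_eq_zero hl fun g hg hgc hgU => by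
    have h1 := h _ (isRegular_domain hU hc (hg.of_le (by exact_mod_cast le_top)) hgc hgU)
    rw [← h1, ← integral_domain hU (f := fun y => g y • W y)]
    · simp only [hW, smul_eq_mul]
    · intro y hy
      simp [image_eq_zero_of_notMem_tsupport fun h => hy (hgU h)]
  have h1 : ∀ᵐ y ∂(volume.restrict U), W y = 0 := (ae_restrict_iff' hU.measurableSet).2 h0
  rw [← hmp.map_eq, he.ae_map_iff] at h1
  filter_upwards [h1] with x hx
  rw [← hW x, hx]
  rfl

end Domain

end TVFlow
end

noncomputable section

namespace TVFlow

/-! ### Flat tori -/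

section Torus

variable {n : ℕ} (τ : Fin n → ℝ)

local notation "E" n => EuclideanSpace ℝ (Fin n)

theorem torusProj_add (y z : E n) : torusProj τ (y + z) = torusProj τ y + torusProj τ z := by
  ext i
  simp [torusProj]

theorem isOpenQuotientMap_torusProj : IsOpenQuotientMap (torusProj τ) := by
  have h1 : IsOpenQuotientMap (Pi.map fun i (r : ℝ) => (r : AddCircle (τ i))) :=
    IsOpenQuotientMap.piMap fun i => QuotientAddGroup.isOpenQuotientMap_mk
  exact h1.comp (EuclideanSpace.equiv (Fin n) ℝ).toHomeomorph.isOpenQuotientMap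

/-- The derivative in the direction `v` of a function on the torus. -/
def torusDeriv (F : (∀ i, AddCircle (τ i)) → ℝ) (v : E n) (x : ∀ i, AddCircle (τ i)) : ℝ :=
  fderiv ℝ (fun y => F (torusProj τ y))
    (Function.surjInv (isOpenQuotientMap_torusProj τ).surjective x) v

variable {τ}

/-- The lift is invariant under translation by `y' - y`, so its derivative descends to the torus. -/
theorem fderiv_comp_torusProj_congr {X : Type*} [NormedAddCommGroup X] [NormedSpace ℝ X]
    (F : (∀ i, AddCircle (τ i)) → X) {y y' : E n}
    (h : torusProj τ y = torusProj τ y') :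
    fderiv ℝ (fun z => F (torusProj τ z)) y = fderiv ℝ (fun z => F (torusProj τ z)) y' := by
  have e : (fun z => F (torusProj τ (z + (y' - y)))) = fun z => F (torusProj τ z) := by
    funext z
    have h0 : torusProj τ (y' - y) = 0 := by
      have := torusProj_add τ y (y' - y)
      rw [add_sub_cancel, h] at this
      exact left_eq_add.1 this
    rw [torusProj_add, h0, add_zero]
  have := fderiv_comp_add_right (𝕜 := ℝ) (f := fun z => F (torusProj τ z)) (x := y) (y' - y)
  rw [e, add_sub_cancel] at this
  exact this

theorem torusDeriv_torusProj (F : (∀ i, AddCircle (τ i)) → ℝ) (v y : E n) :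
    torusDeriv τ F v (torusProj τ y) = fderiv ℝ (fun z => F (torusProj τ z)) y v := by
  rw [torusDeriv, fderiv_comp_torusProj_congr F (Function.surjInv_eq _ _)]

theorem continuous_of_comp_torusProj {X : Type*} [TopologicalSpace X]
    {F : (∀ i, AddCircle (τ i)) → X} (hF : Continuous fun y => F (torusProj τ y)) :
    Continuous F :=
  (isOpenQuotientMap_torusProj τ).isQuotientMap.continuous_iff.2 hF

theorem continuous_torusDeriv {F : (∀ i, AddCircle (τ i)) → ℝ}
    (hF : ContDiff ℝ 1 fun y => F (torusProj τ y)) (v : E n) : Continuous (torusDeriv τ F v) := by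
  refine continuous_of_comp_torusProj ?_
  simp only [torusDeriv_torusProj]
  have := hF.continuous_fderiv one_ne_zero
  fun_prop

variable [∀ i, Fact (0 < τ i)]

theorem memLp_torus_of_continuous {F : (∀ i, AddCircle (τ i)) → ℝ} (hF : Continuous F)
    {p : ℝ≥0∞} : MemLp F p volume := by
  obtain ⟨C, hC⟩ := isCompact_univ.exists_bound_of_continuousOn hF.continuousOn
  exact MemLp.of_bound hF.aestronglyMeasurable C (Filter.Eventually.of_forall fun x => hC x trivial)

/-- Integrating the derivative along the segment from `x` to `x + v` gives an increment of `F`,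
whose integral over `x` vanishes by translation invariance. By Fubini and the same invariance, that
integral is also the left-hand side. -/
theorem integral_torusDeriv {F : (∀ i, AddCircle (τ i)) → ℝ}
    (hF : ContDiff ℝ 1 fun y => F (torusProj τ y)) (v : E n) :
    ∫ x, torusDeriv τ F v x = 0 := by
  have hFc : Continuous F := continuous_of_comp_torusProj hF.continuous
  have hD := continuous_torusDeriv hF v
  have hpc := (isOpenQuotientMap_torusProj τ).continuous
  have hline : ∀ x, ∫ s in (0 : ℝ)..1, torusDeriv τ F v (x + torusProj τ (s • v)) =
      F (x + torusProj τ v) - F x := by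
    intro x
    obtain ⟨y, rfl⟩ := (isOpenQuotientMap_torusProj τ).surjective x
    simp only [← torusProj_add, torusDeriv_torusProj]
    have hd : ∀ s : ℝ, HasDerivAt (fun s : ℝ => F (torusProj τ (y + s • v)))
        (fderiv ℝ (fun z => F (torusProj τ z)) (y + s • v) v) s := by
      intro s
      have h1 : HasDerivAt (fun s : ℝ => y + s • v) v s := by
        simpa using ((hasDerivAt_id s).smul_const v).const_add y
      exact ((hF.differentiable one_ne_zero _).hasFDerivAt).comp_hasDerivAt s h1
    rw [intervalIntegral.integral_eq_sub_of_hasDerivAt (fun s _ => hd s)]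
    · simp
    · have := hF.continuous_fderiv one_ne_zero
      exact Continuous.intervalIntegrable (by fun_prop) _ _
  have hsw : ∫ x, ∫ s in (0 : ℝ)..1, torusDeriv τ F v (x + torusProj τ (s • v)) =
      ∫ s in (0 : ℝ)..1, ∫ x, torusDeriv τ F v (x + torusProj τ (s • v)) := by
    simp only [intervalIntegral.integral_of_le zero_le_one]
    refine integral_integral_swap ?_
    obtain ⟨C, hC⟩ := isCompact_univ.exists_bound_of_continuousOn hD.continuousOn
    refine (MemLp.of_bound (p := 1) (Continuous.aestronglyMeasurable ?_) C
      (Filter.Eventually.of_forall fun x => hC _ trivial)).integrable le_rfl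
    exact hD.comp (continuous_fst.add (hpc.comp (by fun_prop)))
  have hl : ∫ x, (F (x + torusProj τ v) - F x) = 0 := by
    rw [integral_sub, integral_add_right_eq_self F, sub_self]
    · exact (memLp_torus_of_continuous (p := 1) (by fun_prop)).integrable le_rfl
    · exact (memLp_torus_of_continuous (p := 1) hFc).integrable le_rfl
  simp only [hline, integral_add_right_eq_self (torusDeriv τ F v), hl] at hsw
  simpa using hsw.symm

/-- By the product rule the two integrands sum to a divergence, which has integral zero. -/
theorem integral_mul_divergence_torus {G : (∀ i, AddCircle (τ i)) → ℝ}
    (hG : ContDiff ℝ 1 fun y => G (torusProj τ y)) {φ : (∀ i, AddCircle (τ i)) → E n}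
    (hφ : ContDiff ℝ 1 fun y => φ (torusProj τ y)) {d : (∀ i, AddCircle (τ i)) → ℝ}
    (hd : ∀ y, d (torusProj τ y) = divergence (fun z => φ (torusProj τ z)) y) :
    ∫ x, G x * d x = -∫ x, ∑ i, torusDeriv τ G (EuclideanSpace.single i 1) x * φ x i := by
  have hφi : ∀ i, ContDiff ℝ 1 fun y => φ (torusProj τ y) i := fun i =>
    (EuclideanSpace.proj (𝕜 := ℝ) i).contDiff.comp hφ
  have e : ∀ x, G x * d x + ∑ i, torusDeriv τ G (EuclideanSpace.single i 1) x * φ x i =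
      ∑ i, torusDeriv τ (fun z => G z * φ z i) (EuclideanSpace.single i 1) x := by
    intro x
    obtain ⟨y, rfl⟩ := (isOpenQuotientMap_torusProj τ).surjective x
    simp only [hd, torusDeriv_torusProj, divergence, Finset.mul_sum, ← Finset.sum_add_distrib]
    refine Finset.sum_congr rfl fun i _ => ?_
    rw [fderiv_fun_mul (hG.differentiable one_ne_zero y) ((hφi i).differentiable one_ne_zero y)]
    simp [fderiv_apply_coord hφ, mul_comm]
  have hGc : Continuous G := continuous_of_comp_torusProj hG.continuous
  have hφc : Continuous φ := continuous_of_comp_torusProj hφ.continuous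
  have hdc : Continuous d := continuous_of_comp_torusProj (by
    simpa only [hd] using continuous_divergence hφ)
  have hDc := fun i => continuous_torusDeriv hG (EuclideanSpace.single i 1)
  rw [eq_neg_iff_add_eq_zero, ← integral_add]
  · simp only [e]
    rw [integral_finsetSum]
    · exact Finset.sum_eq_zero fun i _ => integral_torusDeriv (hG.mul (hφi i)) _
    · exact fun i _ => (memLp_torus_of_continuous (p := 1)
        (continuous_torusDeriv (hG.mul (hφi i)) _)).integrable le_rfl
  · exact (memLp_torus_of_continuous (p := 1) (by fun_prop)).integrable le_rfl
  · exact (memLp_torus_of_continuous (p := 1) (by fun_prop)).integrable le_rfl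

/-- Functions on the torus with continuously differentiable periodic lift. -/
def contDiffSubalgebra (τ : Fin n → ℝ) : Subalgebra ℝ C(∀ i, AddCircle (τ i), ℝ) where
  carrier := {F | ContDiff ℝ 1 fun y : E n => F (torusProj τ y)}
  mul_mem' {F G} (hF : ContDiff ℝ 1 fun y : E n => F (torusProj τ y))
    (hG : ContDiff ℝ 1 fun y : E n => G (torusProj τ y)) := hF.mul hG
  add_mem' {F G} (hF : ContDiff ℝ 1 fun y : E n => F (torusProj τ y))
    (hG : ContDiff ℝ 1 fun y : E n => G (torusProj τ y)) := hF.add hG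
  algebraMap_mem' r := (contDiff_const : ContDiff ℝ 1 fun _ : E n => r)

/-- Points differing in a coordinate are separated by the real or imaginary part of the injective
character `toCircle`, whose lifts are a cosine and a sine. -/
theorem contDiffSubalgebra_separatesPoints : (contDiffSubalgebra τ).SeparatesPoints := by
  intro x x' hne
  obtain ⟨i, hi⟩ := Function.ne_iff.1 hne
  have hlift : ContDiff ℝ 1 fun y : E n => 2 * Real.pi / τ i * y i :=
    contDiff_const.mul (EuclideanSpace.proj (𝕜 := ℝ) i).contDiff
  have hcirc : ∀ y : E n, ((torusProj τ y i).toCircle : ℂ) =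
      Complex.exp ((2 * Real.pi / τ i * y i : ℝ) * Complex.I) := by
    intro y
    rw [torusProj, AddCircle.toCircle_apply_mk, Circle.coe_exp]
  have hcont : Continuous fun z : ∀ i, AddCircle (τ i) => ((z i).toCircle : ℂ) :=
    continuous_subtype_val.comp (AddCircle.continuous_toCircle.comp (continuous_apply i))
  have hne' : ((x i).toCircle : ℂ) ≠ (x' i).toCircle := fun h =>
    hi (AddCircle.injective_toCircle (Fact.out : 0 < τ i).ne' (Subtype.ext h))
  by_cases hre : ((x i).toCircle : ℂ).re = ((x' i).toCircle : ℂ).re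
  · have him : ((x i).toCircle : ℂ).im ≠ ((x' i).toCircle : ℂ).im := fun h =>
      hne' (Complex.ext hre h)
    refine ⟨_, ⟨⟨_, Complex.continuous_im.comp hcont⟩, ?_, rfl⟩, him⟩
    change ContDiff ℝ 1 fun y : E n => ((torusProj τ y i).toCircle : ℂ).im
    simp only [hcirc, Complex.exp_ofReal_mul_I_im]
    exact hlift.sin
  · refine ⟨_, ⟨⟨_, Complex.continuous_re.comp hcont⟩, ?_, rfl⟩, hre⟩
    change ContDiff ℝ 1 fun y : E n => ((torusProj τ y i).toCircle : ℂ).re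
    simp only [hcirc, Complex.exp_ofReal_mul_I_re]
    exact hlift.cos

theorem memLp_of_isTestField_torus (pos : ∀ i, 0 < τ i) {φ : (∀ i, AddCircle (τ i)) → E n}
    {d : (∀ i, AddCircle (τ i)) → ℝ} (h : IsTestField (.torus τ pos) φ d) : MemLp d 2 volume := by
  refine memLp_torus_of_continuous (continuous_of_comp_torusProj ?_)
  rw [funext h.2]
  exact continuous_divergence (h.1.of_le (by exact_mod_cast le_top))

theorem isRegular_torus (pos : ∀ i, 0 < τ i) {G : (∀ i, AddCircle (τ i)) → ℝ}
    (hG : ContDiff ℝ 1 fun y => G (torusProj τ y)) : IsRegular (.torus τ pos) G := by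
  have hGc : Continuous G := continuous_of_comp_torusProj hG.continuous
  have hDc := fun i => continuous_torusDeriv hG (EuclideanSpace.single i 1)
  obtain ⟨M, hM⟩ := isCompact_univ.exists_bound_of_continuousOn
    (continuous_finsetSum Finset.univ fun i _ => (hDc i).norm).continuousOn
  refine ⟨memLp_torus_of_continuous hGc, M.toNNReal, univ,
    (isCompact_univ : IsCompact (univ : Set (∀ i, AddCircle (τ i)))), fun φ d h => ?_⟩
  change ‖∫ x : (∀ i, AddCircle (τ i)), G x * d x‖ₑ ≤
    _ * ∫⁻ x : (∀ i, AddCircle (τ i)) in univ, ‖φ x‖ₑ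
  rw [integral_mul_divergence_torus hG (h.1.of_le (by exact_mod_cast le_top)) h.2, enorm_neg,
    Measure.restrict_univ, ← lintegral_const_mul' _ _ ENNReal.coe_ne_top]
  refine (enorm_integral_le_lintegral_enorm _).trans (lintegral_mono fun x => ?_)
  have h1 : ‖∑ i, torusDeriv τ G (EuclideanSpace.single i 1) x * φ x i‖ ≤ M * ‖φ x‖ := by
    calc _ ≤ ∑ i, ‖torusDeriv τ G (EuclideanSpace.single i 1) x * φ x i‖ := norm_sum_le _ _
      _ ≤ ∑ i, ‖torusDeriv τ G (EuclideanSpace.single i 1) x‖ * ‖φ x‖ := by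
        refine Finset.sum_le_sum fun i _ => ?_
        rw [norm_mul]
        exact mul_le_mul_of_nonneg_left (PiLp.norm_apply_le _ _) (norm_nonneg _)
      _ = (∑ i, ‖torusDeriv τ G (EuclideanSpace.single i 1) x‖) * ‖φ x‖ := by
        rw [Finset.sum_mul]
      _ ≤ M * ‖φ x‖ := mul_le_mul_of_nonneg_right
        ((le_abs_self _).trans (hM x trivial)) (norm_nonneg _)
  rw [← ofReal_norm, ← ofReal_norm]
  refine (ENNReal.ofReal_le_ofReal h1).trans_eq ?_
  rw [ENNReal.ofReal_mul' (norm_nonneg _)]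
  rfl

/-- By Stone–Weierstrass the `C¹` functions are dense among continuous ones, hence in `L²`; an
element orthogonal to them all vanishes. -/
theorem ae_eq_zero_of_isRegular_torus (pos : ∀ i, 0 < τ i) {w : (∀ i, AddCircle (τ i)) → ℝ}
    (hw : MemLp w 2 volume)
    (h : ∀ G : (∀ i, AddCircle (τ i)) → ℝ, IsRegular (.torus τ pos) G → ∫ x, G x * w x = 0) :
    w =ᵐ[volume] 0 := by
  have hd : Dense ((contDiffSubalgebra τ : Set C(∀ i, AddCircle (τ i), ℝ))) := by
    rw [dense_iff_closure_eq, ← Subalgebra.topologicalClosure_coe,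
      ContinuousMap.subalgebra_topologicalClosure_eq_top_of_separatesPoints _
        (contDiffSubalgebra_separatesPoints (τ := τ)), Algebra.coe_top]
  have hd2 := (ContinuousMap.toLp_denseRange ℝ (volume : Measure (∀ i, AddCircle (τ i))) ℝ
    (p := 2) (by simp)).dense_image (ContinuousLinearMap.continuous _) hd
  have h0 : hw.toLp = 0 := by
    have h1 := Continuous.ext_on hd2 (f := fun z => inner ℝ z hw.toLp) (g := fun _ => (0 : ℝ))
      (by fun_prop) continuous_const ?_
    · exact inner_self_eq_zero.1 (congrFun h1 hw.toLp)
    rintro _ ⟨F, hF, rfl⟩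
    change inner ℝ _ _ = (0 : ℝ)
    rw [L2.inner_def, ← h F (isRegular_torus pos hF)]
    refine integral_congr_ae ?_
    filter_upwards [ContinuousMap.coeFn_toLp (p := 2) (𝕜 := ℝ) volume F, hw.coeFn_toLp] with x h1 h2
    rw [h1, h2]
    simp [mul_comm]
  exact (Lp.eq_zero_iff_ae_eq_zero.1 h0).symm.trans hw.coeFn_toLp |>.symm

end Torus

end TVFlow
end

noncomputable section

namespace TVFlow

/-! ### The energy as a support functional on `L²_b(Ω)` -/

section Energy

variable {n : ℕ}

theorem memLp_of_isTestField {Ω : Region n} {φ : Ω → EuclideanSpace ℝ (Fin n)} {d : Ω → ℝ}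
    (h : IsTestField Ω φ d) : MemLp d 2 (volume : Measure Ω) := by
  cases Ω with
  | domain U hU hc => exact memLp_of_isTestField_domain hU hc h
  | torus τ pos =>
    have : ∀ i, Fact (0 < τ i) := fun i => ⟨pos i⟩
    exact memLp_of_isTestField_torus pos h

theorem ae_eq_zero_of_isRegular {Ω : Region n} {w : Ω → ℝ} (hw : MemLp w 2 (volume : Measure Ω))
    (h : ∀ G : Ω → ℝ, IsRegular Ω G → ∫ x, G x * w x = 0) : w =ᵐ[(volume : Measure Ω)] 0 := by
  cases Ω with
  | domain U hU hc => exact ae_eq_zero_of_isRegular_domain hU hc hw h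
  | torus τ pos =>
    have : ∀ i, Fact (0 < τ i) := fun i => ⟨pos i⟩
    exact ae_eq_zero_of_isRegular_torus pos hw h

variable {Ω : Region n} {b : Ω → ℝ}

theorem ae_weightedMeasure (hb : IsAdmissibleDensity Ω b) :
    ae (weightedMeasure Ω b) = ae (volume : Measure Ω) := by
  refine le_antisymm (withDensity_absolutelyContinuous _ _).ae_le ?_
  refine (withDensity_absolutelyContinuous' hb.memLp.aestronglyMeasurable.aemeasurable.ennreal_ofReal
    ?_).ae_le
  filter_upwards [hb.pos] with x hx
  simpa using hx

/-- The functionals `u ↦ -∫ u div φ` for admissible fields `φ`, as elements of `L²_b(Ω)`. -/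
def testSet (Ω : Region n) (a : Ω → ℝ≥0∞) (b : Ω → ℝ) : Set (L2b Ω b) :=
  {f | ∃ φ d, IsTestField Ω φ d ∧ (∀ x, ENNReal.ofReal ‖φ x‖ ≤ a x) ∧
    f =ᵐ[(volume : Measure Ω)] fun x => -(1 / b x * d x)}

theorem exists_ae_eq_div (hb : IsAdmissibleDensity Ω b) {d : Ω → ℝ}
    (hd : MemLp d 2 (volume : Measure Ω)) :
    ∃ f : L2b Ω b, f =ᵐ[(volume : Measure Ω)] fun x => -(1 / b x * d x) := by
  have h1 : MemLp (fun x => 1 / b x * d x) 2 (volume : Measure Ω) := hd.mul hb.memLp_inv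
  have h2 := (memLp_weightedMeasure_iff Ω b hb _).2 h1.neg
  exact ⟨h2.toLp, (ae_weightedMeasure hb) ▸ h2.coeFn_toLp⟩

theorem inner_eq_neg_integral (hb : IsAdmissibleDensity Ω b) (u : L2b Ω b) {f : L2b Ω b}
    {d : Ω → ℝ} (hf : f =ᵐ[(volume : Measure Ω)] fun x => -(1 / b x * d x)) :
    inner ℝ u f = -∫ x, u x * d x := by
  rw [inner_L2b Ω b hb, ← integral_neg]
  refine integral_congr_ae ?_
  filter_upwards [hf, hb.pos] with x hx hbx
  rw [hx]
  field_simp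

theorem zero_mem_testSet (a : Ω → ℝ≥0∞) (hb : IsAdmissibleDensity Ω b) :
    (0 : L2b Ω b) ∈ testSet Ω a b := by
  refine ⟨0, 0, isTestField_zero Ω, fun x => ?_, ?_⟩
  · change ENNReal.ofReal ‖(0 : EuclideanSpace ℝ (Fin n))‖ ≤ a x
    simp
  · have := Lp.coeFn_zero ℝ 2 (weightedMeasure Ω b)
    rw [Filter.EventuallyEq, ae_weightedMeasure hb] at this
    filter_upwards [this] with x hx
    rw [hx]
    change (0 : ℝ) = -(1 / b x * 0)
    simp

/-- The Riesz representative of `u ↦ -∫ u d` is `-d / b`: the weight in the inner product cancels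
the division by `b`. This brings the abstract theory to bear on `TV_a`. -/
theorem energy_eq_iSup (a : Ω → ℝ≥0∞) (hb : IsAdmissibleDensity Ω b) (u : L2b Ω b) :
    energy Ω a b u = ⨆ f ∈ testSet Ω a b, ((inner ℝ u f : ℝ) : EReal) := by
  refine le_antisymm ?_ ?_
  · refine iSup_le fun φ => iSup_le fun d => iSup_le fun h => iSup_le fun hle => ?_
    obtain ⟨f, hf⟩ := exists_ae_eq_div hb (memLp_of_isTestField h)
    rw [← inner_eq_neg_integral hb u hf]
    exact le_iSup₂ (f := fun f (_ : f ∈ testSet Ω a b) => ((inner ℝ u f : ℝ) : EReal)) f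
      ⟨φ, d, h, hle, hf⟩
  · refine iSup₂_le fun f ⟨φ, d, h, hle, hf⟩ => ?_
    rw [inner_eq_neg_integral hb u hf]
    exact le_iSup_of_le φ (le_iSup_of_le d (le_iSup_of_le h (le_iSup_of_le hle le_rfl)))

/-! ### Density of the effective domain for locally integrable `a` -/

/-- The vectors on which the functionals in `C` are uniformly bounded. -/
def boundedSubmodule {H : Type*} [NormedAddCommGroup H] [InnerProductSpace ℝ H] (C : Set H) :
    Submodule ℝ H where
  carrier := {u | ∃ c : ℝ, ∀ f ∈ C, |inner ℝ u f| ≤ c}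
  zero_mem' := ⟨0, fun f _ => by simp⟩
  add_mem' := by
    rintro u v ⟨c, hc⟩ ⟨c', hc'⟩
    refine ⟨c + c', fun f hf => ?_⟩
    rw [inner_add_left]
    exact (abs_add_le _ _).trans (add_le_add (hc f hf) (hc' f hf))
  smul_mem' := by
    rintro r u ⟨c, hc⟩
    refine ⟨|r| * c, fun f hf => ?_⟩
    rw [real_inner_smul_left, abs_mul]
    exact mul_le_mul_of_nonneg_left (hc f hf) (abs_nonneg r)

theorem boundedSubmodule_subset_effectiveDomain (a : Ω → ℝ≥0∞) (hb : IsAdmissibleDensity Ω b) :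
    (boundedSubmodule (testSet Ω a b) : Set (L2b Ω b)) ⊆ effectiveDomain (energy Ω a b) := by
  rintro u ⟨c, hc⟩
  refine lt_of_le_of_lt (b := (c : EReal)) ?_ (EReal.coe_lt_top c)
  rw [energy_eq_iSup a hb]
  exact iSup₂_le fun f hf => EReal.coe_le_coe_iff.2 ((le_abs_self _).trans (hc f hf))

/-- Regularity and `‖φ‖ ≤ a` give the bound `M * ∫⁻ x in A, a x`, the same for all admissible fields
and finite by local integrability. -/
theorem mem_boundedSubmodule_of_isRegular {a : Ω → ℝ≥0∞} (hb : IsAdmissibleDensity Ω b)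
    (ha : ∀ A : Set Ω, IsCompact A → ∫⁻ x in A, a x < ∞) {G : Ω → ℝ} (hG : IsRegular Ω G)
    {u : L2b Ω b} (hu : u =ᵐ[(volume : Measure Ω)] G) :
    u ∈ boundedSubmodule (testSet Ω a b) := by
  obtain ⟨-, M, A, hA, hM⟩ := hG
  refine ⟨(M * ∫⁻ x in A, a x).toReal, fun f ⟨φ, d, h, hle, hf⟩ => ?_⟩
  have e : ∫ x, u x * d x = ∫ x, G x * d x := by
    refine integral_congr_ae ?_
    filter_upwards [hu] with x hx
    rw [hx]
  rw [inner_eq_neg_integral hb u hf, abs_neg, e]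
  refine (ENNReal.ofReal_le_iff_le_toReal (ENNReal.mul_lt_top ENNReal.coe_lt_top (ha A hA)).ne).1 ?_
  rw [← Real.norm_eq_abs, ofReal_norm]
  refine (hM φ d h).trans ?_
  gcongr with x
  rw [← ofReal_norm]
  exact hle x

/-- The bounded vectors form a subspace, so density reduces to a trivial orthogonal complement. If
`w` is orthogonal to it, then `b * w` integrates to zero against every regular function, hence
vanishes, and `b > 0`. -/
theorem closure_effectiveDomain_eq_univ {a : Ω → ℝ≥0∞} (hb : IsAdmissibleDensity Ω b)
    (ha : ∀ A : Set Ω, IsCompact A → ∫⁻ x in A, a x < ∞) :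
    closure (effectiveDomain (energy Ω a b)) = univ := by
  refine (Dense.mono (boundedSubmodule_subset_effectiveDomain a hb) ?_).closure_eq
  rw [Submodule.dense_iff_topologicalClosure_eq_top, Submodule.topologicalClosure_eq_top_iff,
    Submodule.eq_bot_iff]
  intro w hw
  have hwm : MemLp w 2 (volume : Measure Ω) := (memLp_weightedMeasure_iff Ω b hb w).1 (Lp.memLp w)
  have h0 := ae_eq_zero_of_isRegular (w := fun x => b x * w x) (hwm.mul hb.memLp) fun G hG => by
    have hGm := (memLp_weightedMeasure_iff Ω b hb G).2 hG.1
    have hu : hGm.toLp =ᵐ[(volume : Measure Ω)] G := (ae_weightedMeasure hb) ▸ hGm.coeFn_toLp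
    have h1 := (Submodule.mem_orthogonal _ _).1 hw _ (mem_boundedSubmodule_of_isRegular hb ha hG hu)
    rw [inner_L2b Ω b hb] at h1
    rw [← h1]
    refine integral_congr_ae ?_
    filter_upwards [hu] with x hx
    rw [hx]
    ring
  refine Lp.eq_zero_iff_ae_eq_zero.2 ?_
  rw [Filter.EventuallyEq, ae_weightedMeasure hb]
  filter_upwards [h0, hb.pos] with x hx hbx
  exact (mul_eq_zero.1 hx).resolve_left hbx.ne'

end Energy

end TVFlow
end

theorem mainTheorem8 {n : ℕ} (Ω : TVFlow.Region n)
    (b : Ω → ℝ) (hb : TVFlow.IsAdmissibleDensity Ω b)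
    (a : Ω → ℝ≥0∞) (ha : LowerSemicontinuous a) :
    (∀ u₀ ∈ closure (TVFlow.effectiveDomain (TVFlow.energy Ω a b)),
      ∃! u : C(ℝ≥0, TVFlow.L2b Ω b), TVFlow.IsGradientFlow (TVFlow.energy Ω a b) u₀ u) ∧
    ((∀ K : Set Ω, IsCompact K → ∫⁻ x in K, a x < ∞) →
      ∀ u₀ : TVFlow.L2b Ω b,
        ∃! u : C(ℝ≥0, TVFlow.L2b Ω b), TVFlow.IsGradientFlow (TVFlow.energy Ω a b) u₀ u) := by
  have main : ∀ u₀ ∈ closure (TVFlow.effectiveDomain (TVFlow.energy Ω a b)),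
      ∃! u : C(ℝ≥0, TVFlow.L2b Ω b), TVFlow.IsGradientFlow (TVFlow.energy Ω a b) u₀ u :=
    fun u₀ hu₀ => ConvexFlow.existsUnique_isGradientFlow (TVFlow.zero_mem_testSet a hb)
      (TVFlow.energy_eq_iSup a hb) hu₀
  refine ⟨main, fun hloc u₀ => main u₀ ?_⟩
  rw [TVFlow.closure_effectiveDomain_eq_univ hb hloc]
  trivial
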